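/- Let $\mathbb T=\mathbb R/\mathbb Z$, let $|\cdot|$ denote the distance to $0$ on $\mathbb T$, and let $h\in C^\infty(\mathbb T,\mathbb T)$ satisfy $h(0)=0$, $h'(0)=0$, $h'(x)>0$ for all $x\neq0$, $h'''(0)>0$ and $h(-x)=-h(x)$. Let $T:\mathbb T^2\to\mathbb T^2$ be the invertible map $T(x,y)=(x+h(x)+y,\;h(x)+y)$. For constants $K_-,K_+>0$ and $\xi=(x,y)\in\mathbb T^2$ put $$\mathcal C_*(\xi)=\{(1,u)\in\mathbb R^2 : K_-(|x|+\sqrt{|y|})\le u\le K_+(|x|+\sqrt{|y|})\}.$$ For $\xi\in\mathbb T^2$, $n\in\mathbb N=\{0,1,2,\dots\}$ and $u,v\ge0$ define $\lambda_{u,n}(\xi,u)$, $F_n(\xi,u)$, $\mu_{s,n}(\xi,v)$, $F^-_n(\xi,v)$ by $$D_{T^{-n}\xi}T^n(1,u)=\lambda_{u,n}(\xi,u)\,(1,F_n(\xi,u)),\qquad D_\xi T^{-n}(1,-v)=\mu_{s,n}(\xi,v)\,(1,-F^-_n(\xi,v)).$$ Then for all $K_-,K_+>0$ there exists $K>0$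 (depending only on $h,K_-,K_+$) such that the following hold. (1) (Expansion) For each $\xi=(x,y)\in\mathbb T^2\setminus\{0\}$, each $n\in\mathbb N$ and each $(1,u)\in\mathcal C_*(T^{-n}\xi)$, $$\lambda_{u,n}(\xi,u)\ \ge\ e^{-K|x|}\,(K^{-1}|x|\,n+1)^2 .$$ (2) (Contraction) For each $\xi=(x,y)\in\mathbb T^2$, each $n\in\mathbb N$, each $(1,u)\in\mathcal C_*(T^{-n}\xi)$ and each $v\ge0$, writing $u_{-n}=u$, $u_0=F_n(\xi,u)$, $v_0=v$, $v_{-n}=F^-_n(\xi,v)$, $$\mu_{s,n}(\xi,v_0)\ \ge\ e^{-K|x|}\,(K^{-1}|x|\,n+1)^2\;\frac{u_0+v_0}{u_{-n}+v_{-n}} ,$$ where the quotient is read as $0$ in the trivial case $\xi=0$, $u=v=0$, the only one in which its denominator vanishes. -/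

import Mathlib

open scoped ContDiff

/-- The two-torus `𝕋² = (ℝ/ℤ)²`. -/
abbrev Torus2 : Type := UnitAddCircle × UnitAddCircle

/-- The covering projection `ℝ² → 𝕋²`. -/
def torusProj (p : ℝ × ℝ) : Torus2 := ((p.1 : UnitAddCircle), (p.2 : UnitAddCircle))

/-- The representative in `[0,1)²` of a point of the torus. -/
noncomputable def torusRep (ξ : Torus2) : ℝ × ℝ :=
  ((AddCircle.equivIco (1 : ℝ) 0 ξ.1 : ℝ), (AddCircle.equivIco (1 : ℝ) 0 ξ.2 : ℝ))

/-- The map `T(x,y) = (x + h(x) + y, h(x) + y)` of the torus, bundled with its inverse. -/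
def intermittentMap (h : UnitAddCircle → UnitAddCircle) : Torus2 ≃ Torus2 where
  toFun ξ := (ξ.1 + h ξ.1 + ξ.2, h ξ.1 + ξ.2)
  invFun ξ := (ξ.1 - ξ.2, ξ.2 - h (ξ.1 - ξ.2))
  left_inv := by
    rintro ⟨x, y⟩
    have e : x + h x + y - (h x + y) = x := by abel
    simp [e]
  right_inv := by
    rintro ⟨x, y⟩
    ext <;> simp

/-- `H : ℝ → ℝ` is a smooth lift of the circle map `h`; a circle map is smooth iff it has one, and
two lifts of the same map differ by an integer constant. -/
structure IsSmoothLift (h : UnitAddCircle → UnitAddCircle) (H : ℝ → ℝ) : Prop where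
  contDiff : ContDiff ℝ ∞ H
  coe_apply : ∀ x : ℝ, h (x : UnitAddCircle) = ((H x : ℝ) : UnitAddCircle)

/-- The standing assumptions on `h`, its derivatives being those of a lift `H`. -/
structure IsNeutralFamily (h : UnitAddCircle → UnitAddCircle) (H : ℝ → ℝ) : Prop where
  lift : IsSmoothLift h H
  map_zero : h 0 = 0
  deriv_zero : deriv H 0 = 0
  deriv_pos : ∀ x : ℝ, (x : UnitAddCircle) ≠ 0 → 0 < deriv H x
  third_deriv_pos : 0 < iteratedDeriv 3 H 0
  map_neg : ∀ x : UnitAddCircle, h (-x) = -h x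

/-- The lift of `T` to `ℝ²`. -/
def liftMap (H : ℝ → ℝ) (p : ℝ × ℝ) : ℝ × ℝ := (p.1 + H p.1 + p.2, H p.1 + p.2)

/-- The lift of `T⁻¹` to `ℝ²`. -/
def liftInv (H : ℝ → ℝ) (p : ℝ × ℝ) : ℝ × ℝ := (p.1 - p.2, p.2 - H (p.1 - p.2))

/-- The derivative `D_ζ Tⁿ`, in the flat coordinates of the torus. -/
noncomputable def tangentFwd (H : ℝ → ℝ) (n : ℕ) (ζ : Torus2) : ℝ × ℝ →L[ℝ] ℝ × ℝ :=
  fderiv ℝ (liftMap H)^[n] (torusRep ζ)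

/-- The derivative `D_ξ T⁻ⁿ`, in the flat coordinates of the torus. -/
noncomputable def tangentBwd (H : ℝ → ℝ) (n : ℕ) (ξ : Torus2) : ℝ × ℝ →L[ℝ] ℝ × ℝ :=
  fderiv ℝ (liftInv H)^[n] (torusRep ξ)

/-- The expansion `λ_{u,n}(ξ,u)`, where `D_{T⁻ⁿξ} Tⁿ (1,u) = λ_{u,n}(ξ,u) (1, F_n(ξ,u))`. -/
noncomputable def expansion (h : UnitAddCircle → UnitAddCircle) (H : ℝ → ℝ) (n : ℕ)
    (ξ : Torus2) (u : ℝ) : ℝ :=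
  (tangentFwd H n ((intermittentMap h).symm^[n] ξ) (1, u)).1

/-- The slope `F_n(ξ,u)`, where `D_{T⁻ⁿξ} Tⁿ (1,u) = λ_{u,n}(ξ,u) (1, F_n(ξ,u))`. -/
noncomputable def unstableSlope (h : UnitAddCircle → UnitAddCircle) (H : ℝ → ℝ) (n : ℕ)
    (ξ : Torus2) (u : ℝ) : ℝ :=
  (tangentFwd H n ((intermittentMap h).symm^[n] ξ) (1, u)).2 / expansion h H n ξ u

/-- The factor `μ_{s,n}(ξ,v)`, where `D_ξ T⁻ⁿ (1,-v) = μ_{s,n}(ξ,v) (1, -F⁻_n(ξ,v))`. -/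
noncomputable def contraction (H : ℝ → ℝ) (n : ℕ) (ξ : Torus2) (v : ℝ) : ℝ :=
  (tangentBwd H n ξ (1, -v)).1

/-- The slope `F⁻_n(ξ,v)`, where `D_ξ T⁻ⁿ (1,-v) = μ_{s,n}(ξ,v) (1, -F⁻_n(ξ,v))`. -/
noncomputable def stableSlope (H : ℝ → ℝ) (n : ℕ) (ξ : Torus2) (v : ℝ) : ℝ :=
  -(tangentBwd H n ξ (1, -v)).2 / contraction H n ξ v

/-- The narrow cone `{(1,u) | K₋ (|x| + √|y|) ≤ u ≤ K₊ (|x| + √|y|)}` at `ξ = (x,y)`; the norm on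
the circle is the distance to `0`. -/
def narrowCone (Kminus Kplus : ℝ) (ξ : Torus2) : Set (ℝ × ℝ) :=
  {w | w.1 = 1 ∧ Kminus * (‖ξ.1‖ + √‖ξ.2‖) ≤ w.2 ∧ w.2 ≤ Kplus * (‖ξ.1‖ + √‖ξ.2‖)}

/-! The derivatives above do not depend on the representative, and `liftMap`, `liftInv` do lift
the map and its inverse. -/

theorem torusProj_torusRep (ξ : Torus2) : torusProj (torusRep ξ) = ξ := by
  ext
  · exact (AddCircle.equivIco (1 : ℝ) 0).symm_apply_apply ξ.1
  · exact (AddCircle.equivIco (1 : ℝ) 0).symm_apply_apply ξ.2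

theorem torusProj_liftMap {h : UnitAddCircle → UnitAddCircle} {H : ℝ → ℝ}
    (hH : IsSmoothLift h H) (p : ℝ × ℝ) :
    torusProj (liftMap H p) = intermittentMap h (torusProj p) := by
  simp [torusProj, liftMap, intermittentMap, hH.coe_apply]

theorem torusProj_liftInv {h : UnitAddCircle → UnitAddCircle} {H : ℝ → ℝ}
    (hH : IsSmoothLift h H) (p : ℝ × ℝ) :
    torusProj (liftInv H p) = (intermittentMap h).symm (torusProj p) := by
  have e := hH.coe_apply (p.1 - p.2)
  simp only [AddCircle.coe_sub] at e
  simp [torusProj, liftInv, intermittentMap, e]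

/-- Two continuous lifts of one map to the torus have the same derivative at congruent points. -/
theorem fderiv_eq_of_torusProj {f : ℝ × ℝ → ℝ × ℝ} (hf : Continuous f) {S : Torus2 → Torus2}
    (hS : ∀ p, torusProj (f p) = S (torusProj p)) {p q : ℝ × ℝ}
    (hpq : torusProj p = torusProj q) : fderiv ℝ f p = fderiv ℝ f q := by
  have hdisc : IsDiscrete (Set.range (Int.cast : ℤ → ℝ)) := by
    rw [isDiscrete_iff_discreteTopology]
    exact Int.isClosedEmbedding_coe_real.isEmbedding.toHomeomorph.discreteTopology_iff.1 inferInstance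
  have key : ∀ r r' : ℝ, ((r : ℝ) : UnitAddCircle) = (r' : UnitAddCircle) →
      r - r' ∈ Set.range (Int.cast : ℤ → ℝ) := by
    intro r r' e
    have e' : ((r - r' : ℝ) : UnitAddCircle) = 0 := by simp [e]
    obtain ⟨m, hm⟩ := (AddCircle.coe_eq_zero_iff (1 : ℝ)).1 e'
    exact ⟨m, by simpa using hm⟩
  have hper : ∀ r, torusProj (r + (q - p)) = torusProj r := by
    intro r
    simp only [torusProj, Prod.mk.injEq] at hpq ⊢
    simp [hpq.1, hpq.2]
  have hc : Continuous fun r => f (r + (q - p)) - f r := by fun_prop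
  have hmem : ∀ r, torusProj (f (r + (q - p))) = torusProj (f r) := fun r => by
    rw [hS, hS, hper]
  have hconst : ∀ r, f (r + (q - p)) - f r = f (p + (q - p)) - f p := by
    intro r
    ext
    · exact isPreconnected_univ.constant_of_mapsTo hdisc (continuous_fst.comp hc).continuousOn
        (fun s _ => key _ _ (congrArg Prod.fst (hmem s))) (Set.mem_univ r) (Set.mem_univ p)
    · exact isPreconnected_univ.constant_of_mapsTo hdisc (continuous_snd.comp hc).continuousOn
        (fun s _ => key _ _ (congrArg Prod.snd (hmem s))) (Set.mem_univ r) (Set.mem_univ p)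
  have hfun : (fun r => f (r + (q - p))) = fun r => f r + (f (p + (q - p)) - f p) := by
    funext r
    rw [← hconst r]; abel
  have h1 := fderiv_comp_add_right (𝕜 := ℝ) (f := f) (x := p) (q - p)
  rw [hfun, fderiv_add_const] at h1
  simpa using h1

theorem tangentFwd_torusProj {h : UnitAddCircle → UnitAddCircle} {H : ℝ → ℝ}
    (hH : IsSmoothLift h H) (n : ℕ) (p : ℝ × ℝ) :
    tangentFwd H n (torusProj p) = fderiv ℝ (liftMap H)^[n] p := by
  have hc : Continuous H := hH.contDiff.continuous
  refine fderiv_eq_of_torusProj (S := (intermittentMap h)^[n])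
    (Continuous.iterate (by unfold liftMap; fun_prop) n) (fun r => ?_) (torusProj_torusRep _)
  exact (Function.Semiconj.iterate_right (f := torusProj) (torusProj_liftMap hH) n) r

theorem tangentBwd_torusProj {h : UnitAddCircle → UnitAddCircle} {H : ℝ → ℝ}
    (hH : IsSmoothLift h H) (n : ℕ) (p : ℝ × ℝ) :
    tangentBwd H n (torusProj p) = fderiv ℝ (liftInv H)^[n] p := by
  have hc : Continuous H := hH.contDiff.continuous
  refine fderiv_eq_of_torusProj (S := (intermittentMap h).symm^[n])
    (Continuous.iterate (by unfold liftInv; fun_prop) n) (fun r => ?_) (torusProj_torusRep _)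
  exact (Function.Semiconj.iterate_right (f := torusProj) (torusProj_liftInv hH) n) r

/-!
The contraction estimate follows from the expansion estimate: the map preserves area, so
`λ (u₀ + v₀) = μ (u₋ₙ + v₋ₙ)`, and `μ ≥ 1`.

For the expansion, time is indexed backwards: `ξ j = T⁻ʲ ξ`, and the image at `ξ j` of the initial
vector at `ξ n` is `(a j, b j)`. Both components are nonnegative and increase forward in time, so
that `a 0 ≥ a n + n * b n`. The estimate to prove is `a 0 ≥ (1 + ε N n)² a n`, where
`N = max |x| √|y|` is the scale of `ξ 0`, truncated at a constant. In this form it is stable under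
concatenation: orbits are cut at their visits outside a neighbourhood of the origin, where vectors
of the cone are uniformly transverse to the horizontal (`IsNeutralFamily.exists_slope_bound`), and
only pieces of orbits close to the origin remain (`IsCubicGerm.local_expansion`).

On such a piece, of length `m`, the scale changes by `O(scale²)` in one step. For `m = O(1 / N)` the
cone condition at the start and the linear growth of `a` suffice. For larger `m` a factor
`c (N m)²` is needed, with the sharp exponent `2` but an arbitrary `c`. Followed backwards, the orbit
first approaches the origin inside the region `x > 0, y ≥ κ x²` (up to symmetry) and then recedes
from it. Both phases last at most `O(1 / N k)`, where `N k` is the scale at the turning time `k`,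
because `|x| + √|y|` satisfies a discrete version of `|V̇| ≥ c V²`
(`mul_le_of_quadratic_growth`). In the approach phase `y` is the increment of the orbit; as `f` is
convex for `x ≥ 0`, `y` is on the favourable side of the second-order recurrence satisfied by `a`,
and their Wronskian is monotone (`IsCubicGerm.wronskian_le`). Hence `a 0 / a k` is at least a
constant times `y 0 / y k`, that is, a constant times `(N / N k)²`, and this is at least a constant
times `(N m)²`.
-/

/-! ### Local orbits and the homogeneous scale -/

/-- A function that behaves like a cubic on `[-δ, δ]`: odd, pinched between `α x³` and `β x³`, with
nonnegative derivative, and convex to the right of `0` (in the form of the tangent inequality). -/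
structure IsCubicGerm (f : ℝ → ℝ) (α β δ : ℝ) : Prop where
  alpha_pos : 0 < α
  beta_pos : 0 < β
  delta_pos : 0 < δ
  delta_le : δ ≤ 1
  beta_delta_le : (1 + β) * δ ≤ 1
  odd : ∀ x, f (-x) = -f x
  lower : ∀ x, 0 ≤ x → x ≤ δ → α * x ^ 3 ≤ f x
  upper : ∀ x, 0 ≤ x → x ≤ δ → f x ≤ β * x ^ 3
  deriv_nonneg : ∀ x, 0 ≤ deriv f x
  tangent : ∀ x x', 0 ≤ x' → x' ≤ x → x ≤ δ → f x - f x' ≤ deriv f x * (x - x')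

/-- The scale of a point, homogeneous for the weights `1` of `x` and `2` of `y`. -/
noncomputable def scale (x y : ℝ) : ℝ := max |x| √|y|

/-- `(x j, y j)`, `j ≤ m`, is a piece of a backward orbit of `(x, y) ↦ (x + f x + y, f x + y)`. -/
def IsBackwardOrbit (f : ℝ → ℝ) (m : ℕ) (x y : ℕ → ℝ) : Prop :=
  ∀ j < m, x (j + 1) = x j - y j ∧ y (j + 1) = y j - f (x (j + 1))

/-- `(a j, b j)`, `j ≤ m`, is moved by the derivatives `(a, b) ↦ (a + q a + b, q a + b)`; as for the
orbit itself, larger indices are earlier times. -/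
def IsTangentOrbit (q : ℕ → ℝ) (m : ℕ) (a b : ℕ → ℝ) : Prop :=
  ∀ j < m, b j = b (j + 1) + q (j + 1) * a (j + 1) ∧ a j = a (j + 1) + b j

theorem scale_nonneg (x y : ℝ) : 0 ≤ scale x y := le_max_of_le_left (abs_nonneg x)

theorem abs_le_scale (x y : ℝ) : |x| ≤ scale x y := le_max_left _ _

theorem sqrt_le_scale (x y : ℝ) : √|y| ≤ scale x y := le_max_right _ _

theorem abs_le_scale_sq (x y : ℝ) : |y| ≤ scale x y ^ 2 :=
  (Real.sqrt_le_left (scale_nonneg x y)).1 (sqrt_le_scale x y)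

theorem scale_neg (x y : ℝ) : scale (-x) (-y) = scale x y := by simp [scale]

theorem scale_le {x y r : ℝ} (hr : 0 ≤ r) (hx : |x| ≤ r) (hy : |y| ≤ r ^ 2) : scale x y ≤ r :=
  max_le hx ((Real.sqrt_le_left hr).2 hy)

theorem scale_le_add (x y : ℝ) : scale x y ≤ |x| + √|y| :=
  max_le (by linarith [Real.sqrt_nonneg |y|]) (by linarith [abs_nonneg x])

theorem add_le_two_mul_scale (x y : ℝ) : |x| + √|y| ≤ 2 * scale x y := by
  linarith [abs_le_scale x y, sqrt_le_scale x y]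

namespace IsBackwardOrbit

variable {f : ℝ → ℝ} {m : ℕ} {x y : ℕ → ℝ}

theorem shift (h : IsBackwardOrbit f m x y) (k : ℕ) :
    IsBackwardOrbit f (m - k) (fun j => x (k + j)) (fun j => y (k + j)) :=
  fun j hj => h (k + j) (by omega)

theorem neg (h : IsBackwardOrbit f m x y) (hf : ∀ t, f (-t) = -f t) :
    IsBackwardOrbit f m (fun j => -x j) (fun j => -y j) := by
  intro j hj
  obtain ⟨h1, h2⟩ := h j hj
  refine ⟨by simp only [h1]; ring, ?_⟩
  simp only [hf]
  linarith

end IsBackwardOrbit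

/-! ### Positive tangent vectors -/

namespace IsTangentOrbit

variable {q : ℕ → ℝ} {m : ℕ} {a b : ℕ → ℝ}

theorem shift (h : IsTangentOrbit q m a b) (k : ℕ) :
    IsTangentOrbit (fun j => q (k + j)) (m - k) (fun j => a (k + j)) (fun j => b (k + j)) :=
  fun j hj => h (k + j) (by omega)

theorem mono (h : IsTangentOrbit q m a b) {k : ℕ} (hk : k ≤ m) : IsTangentOrbit q k a b :=
  fun j hj => h j (by omega)

theorem pos (h : IsTangentOrbit q m a b) (hq : ∀ j, 0 ≤ q j) (ha : 0 < a m) (hb : 0 ≤ b m)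
    {j : ℕ} (hj : j ≤ m) : 0 < a j ∧ 0 ≤ b j := by
  induction hj using Nat.decreasingInduction with
  | of_succ k hk ih =>
    obtain ⟨h1, h2⟩ := h k hk
    have : 0 ≤ b k := by rw [h1]; have := mul_nonneg (hq (k + 1)) ih.1.le; linarith [ih.2]
    exact ⟨by linarith [ih.1], this⟩
  | self => exact ⟨ha, hb⟩

theorem antitone (h : IsTangentOrbit q m a b) (hq : ∀ j, 0 ≤ q j) (ha : 0 < a m) (hb : 0 ≤ b m)
    {i j : ℕ} (hij : i ≤ j) (hj : j ≤ m) : a j ≤ a i ∧ b j ≤ b i := by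
  induction hij using Nat.decreasingInduction with
  | of_succ k hk ih =>
    obtain ⟨h1, h2⟩ := h k (by omega)
    have h3 := h.pos hq ha hb (j := k + 1) (by omega)
    have h4 := h.pos hq ha hb (j := k) (by omega)
    have := mul_nonneg (hq (k + 1)) h3.1.le
    exact ⟨by linarith [ih.1], by linarith [ih.2]⟩
  | self => exact ⟨le_rfl, le_rfl⟩

theorem add_mul_le (h : IsTangentOrbit q m a b) (hq : ∀ j, 0 ≤ q j) (ha : 0 < a m)
    (hb : 0 ≤ b m) : a m + m * b m ≤ a 0 := by
  have key : ∀ j ≤ m, a m + ((m - j : ℕ) : ℝ) * b m ≤ a j := by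
    intro j hj
    induction hj using Nat.decreasingInduction with
    | of_succ k hk ih =>
      obtain ⟨h1, h2⟩ := h k hk
      have h3 := (h.antitone hq ha hb (i := k) hk.le le_rfl).2
      have e : m - k = (m - (k + 1)) + 1 := by omega
      rw [e]; push_cast; linarith
    | self => simp
  simpa using key 0 (Nat.zero_le m)

end IsTangentOrbit

/-! ### Times spent near the fixed point -/

/-- One step away from the origin: in the relevant quadrant the map pushes `s + √z` outwards at
quadratic speed. -/
theorem add_sqrt_growth {α c s z s' z' : ℝ} (hc0 : 0 < c) (hc1 : c ≤ 1 / 9)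
    (hc2 : 9 * c ≤ 2 * α) (hs : 0 ≤ s) (hs1 : s ≤ 1) (hz : 0 ≤ z) (hs' : s + z ≤ s')
    (hz' : z + α * s ^ 3 ≤ z') : s + √z + c * (s + √z) ^ 2 ≤ s' + √z' := by
  have hα : 0 < α := by linarith
  have hr := Real.sqrt_nonneg z
  have hr2 := Real.sq_sqrt hz
  have hmono : √z ≤ √z' := Real.sqrt_le_sqrt (by nlinarith [pow_nonneg hs 3])
  set r := √z with hrdef
  rcases le_total s (2 * r) with h | h
  · -- `z` dominates: the first coordinate alone gains `z ≥ (s + √z)² / 9`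
    have h1 : (s + r) ^ 2 ≤ 9 * z := by rw [← hr2]; nlinarith
    have h2 : c * (s + r) ^ 2 ≤ z := by nlinarith
    linarith
  · -- `s` dominates: the gain comes from the cubic term
    have h0 : (s + r) ^ 2 ≤ 9 / 4 * s ^ 2 := by nlinarith
    have h1 : c * (s + r) ^ 2 ≤ 9 / 4 * c * s ^ 2 := by
      linarith [mul_le_mul_of_nonneg_left h0 hc0.le]
    have h2 : r + 9 / 4 * c * s ^ 2 ≤ √z' := by
      apply Real.le_sqrt_of_sq_le
      have h3 : (9 / 4 * c) * s ≤ 1 := by nlinarith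
      have h4 : 0 ≤ s ^ 3 := pow_nonneg hs 3
      have h5 : 0 ≤ c * s ^ 2 := by positivity
      have h6 : (9 / 4 * c * s ^ 2) * (2 * r) ≤ (9 / 4 * c * s ^ 2) * s := by gcongr
      have h7 : (9 / 4 * c * s ^ 2) ^ 2 ≤ (9 / 4 * c * s ^ 3) := by
        have : (9 / 4 * c * s ^ 2) ^ 2 = (9 / 4 * c * s ^ 3) * ((9 / 4 * c) * s) := by ring
        rw [this]
        exact mul_le_of_le_one_right (by positivity) h3
      have h8 : 9 / 2 * c * s ^ 3 ≤ α * s ^ 3 := by gcongr; linarith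
      nlinarith
    linarith

/-- A discrete blow-up estimate: `V' = c V²` cannot stay bounded for longer than `O(1 / V₀)`. -/
theorem mul_le_of_quadratic_growth {c : ℝ} (hc0 : 0 < c) (hc1 : c ≤ 1 / 9) {L : ℕ} {V : ℕ → ℝ}
    (h0 : 0 < V 0) (hV : ∀ i < L, V i + c * V i ^ 2 ≤ V (i + 1)) (hB : ∀ i ≤ L, V i ≤ 2) :
    L * V 0 ≤ 2 / c := by
  have key : ∀ i ≤ L, 0 < V i ∧ (V i)⁻¹ ≤ (V 0)⁻¹ - c / 2 * i := by
    intro i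
    induction i with
    | zero => intro _; exact ⟨h0, by simp⟩
    | succ i ih =>
      intro hi
      obtain ⟨h1, h2⟩ := ih (by omega)
      have h3 := hV i (by omega)
      have h4 : 0 < V i + c * V i ^ 2 := by positivity
      refine ⟨by linarith, ?_⟩
      have h5 : (V (i + 1))⁻¹ ≤ (V i + c * V i ^ 2)⁻¹ := inv_anti₀ h4 h3
      have h6 : (V i + c * V i ^ 2)⁻¹ ≤ (V i)⁻¹ - c / 2 := by
        have h7 := hB i (by omega)
        have h8 : c * V i ≤ 1 := by nlinarith
        rw [inv_le_iff_one_le_mul₀ h4]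
        have : ((V i)⁻¹ - c / 2) * (V i + c * V i ^ 2)
            = 1 + c * V i / 2 * (1 - c * V i) := by field_simp; ring
        rw [this]
        have : 0 ≤ c * V i / 2 * (1 - c * V i) := by
          apply mul_nonneg (by positivity); linarith
        linarith
      push_cast
      linarith
  obtain ⟨h1, h2⟩ := key L le_rfl
  have h3 : 0 < (V L)⁻¹ := inv_pos.2 h1
  have h4 : c / 2 * L ≤ (V 0)⁻¹ := by linarith
  have h5 : c / 2 * L * V 0 ≤ 1 := by
    calc c / 2 * L * V 0 ≤ (V 0)⁻¹ * V 0 := by gcongr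
      _ = 1 := inv_mul_cancel₀ h0.ne'
  rw [le_div_iff₀ hc0]
  linarith

namespace IsCubicGerm

variable {f : ℝ → ℝ} {α β δ : ℝ}

theorem exists_rate (hα : 0 < α) : ∃ c : ℝ, 0 < c ∧ c ≤ 1 / 9 ∧ 9 * c ≤ 2 * α :=
  ⟨min (1 / 9) (2 * α / 9), by positivity, min_le_left _ _, by
    linarith [min_le_right (1 / 9) (2 * α / 9)]⟩

theorem nonneg (hf : IsCubicGerm f α β δ) {x : ℝ} (h0 : 0 ≤ x) (h1 : x ≤ δ) : 0 ≤ f x :=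
  le_trans (mul_nonneg hf.alpha_pos.le (pow_nonneg h0 3)) (hf.lower x h0 h1)

theorem abs_le (hf : IsCubicGerm f α β δ) {x : ℝ} (h1 : |x| ≤ δ) : |f x| ≤ β * |x| ^ 3 := by
  rcases le_total 0 x with h | h
  · rw [abs_of_nonneg h] at h1 ⊢
    rw [abs_of_nonneg (hf.nonneg h h1)]
    exact hf.upper x h h1
  · rw [abs_of_nonpos h] at h1 ⊢
    have h2 := hf.upper (-x) (by linarith) h1
    have h3 := hf.nonneg (x := -x) (by linarith) h1
    rw [hf.odd] at h2 h3
    rw [abs_of_nonpos (by linarith)]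
    exact h2

theorem zero (hf : IsCubicGerm f α β δ) : f 0 = 0 := by
  have := hf.odd 0
  simp at this
  linarith

/-- The scale changes by at most `O(scale²)` in one step. -/
theorem scale_step (hf : IsCubicGerm f α β δ) {x y x' y' : ℝ} (hx : x' = x - y)
    (hy : y' = y - f x') (hN : scale x' y' ≤ δ) :
    scale x y ≤ scale x' y' + (1 + β) * scale x' y' ^ 2 := by
  have h0 := scale_nonneg x' y'
  have h1 := abs_le_scale x' y'
  have h2 := abs_le_scale_sq x' y'
  have h3 := hf.abs_le (h1.trans hN)
  have hβ := hf.beta_pos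
  set N := scale x' y'
  have hN1 : N ≤ 1 := hN.trans hf.delta_le
  have h4 : β * |x'| ^ 3 ≤ β * N ^ 3 := by gcongr
  have h5 : |y| ≤ N ^ 2 + β * N ^ 3 := by
    have : y = y' + f x' := by linarith
    rw [this]
    exact (abs_add_le _ _).trans (by linarith)
  have h6 : β * N ^ 3 ≤ β * N ^ 2 :=
    mul_le_mul_of_nonneg_left (pow_le_pow_of_le_one h0 hN1 (by norm_num)) hβ.le
  refine scale_le (by positivity) ?_ ?_
  · have : x = x' + y := by linarith
    rw [this]
    refine (abs_add_le _ _).trans ?_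
    nlinarith
  · nlinarith [mul_nonneg (mul_nonneg h0 h0) h0, pow_nonneg h0 3,
      mul_nonneg hβ.le (pow_nonneg h0 3), sq_nonneg ((1 + β) * N ^ 2)]

theorem scale_le_two_mul (hf : IsCubicGerm f α β δ) {x y x' y' : ℝ} (hx : x' = x - y)
    (hy : y' = y - f x') (hN : scale x' y' ≤ δ) : scale x y ≤ 2 * scale x' y' := by
  have h1 := hf.scale_step hx hy hN
  have h2 : (1 + β) * scale x' y' ≤ 1 :=
    (mul_le_mul_of_nonneg_left hN (by linarith [hf.beta_pos])).trans hf.beta_delta_le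
  nlinarith [scale_nonneg x' y']

/-- Backwards in time the scale decreases at most like `1 / j`. -/
theorem inv_scale_le (hf : IsCubicGerm f α β δ) {m : ℕ} {x y : ℕ → ℝ}
    (ho : IsBackwardOrbit f m x y) (hN : ∀ j ≤ m, scale (x j) (y j) ≤ δ)
    (h0 : 0 < scale (x 0) (y 0)) {j : ℕ} (hj : j ≤ m) :
    0 < scale (x j) (y j) ∧
      (scale (x j) (y j))⁻¹ ≤ (scale (x 0) (y 0))⁻¹ + (1 + β) * j := by
  induction j with
  | zero => exact ⟨h0, by simp⟩
  | succ j ih =>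
    obtain ⟨h1, h2⟩ := ih (by omega)
    obtain ⟨e1, e2⟩ := ho j (by omega)
    have h3 := hf.scale_step e1 e2 (hN _ hj)
    have h4 := scale_nonneg (x (j + 1)) (y (j + 1))
    have hβ := hf.beta_pos
    set N := scale (x j) (y j)
    set N' := scale (x (j + 1)) (y (j + 1))
    have h5 : 0 < N' := by
      rcases h4.eq_or_lt with h | h
      · rw [← h] at h3; norm_num at h3; linarith
      · exact h
    refine ⟨h5, ?_⟩
    have h6 : N'⁻¹ ≤ N⁻¹ + (1 + β) := by
      have h7 : (N' + (1 + β) * N' ^ 2)⁻¹ ≤ N⁻¹ := inv_anti₀ h1 h3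
      have h8 : N'⁻¹ - (1 + β) ≤ (N' + (1 + β) * N' ^ 2)⁻¹ := by
        have h9 : 0 < N' + (1 + β) * N' ^ 2 := by positivity
        rw [← one_div (N' + (1 + β) * N' ^ 2), le_div_iff₀ h9]
        have : (N'⁻¹ - (1 + β)) * (N' + (1 + β) * N' ^ 2) = 1 - ((1 + β) * N') ^ 2 := by
          field_simp
          ring
        rw [this]
        linarith [sq_nonneg ((1 + β) * N')]
      linarith
    push_cast
    linarith

/-- An orbit which is already on its way out in backward time (opposite signs of `x` and `y`)
leaves within a time `O(1 / scale)`. -/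
theorem time_le_of_nonneg_of_nonpos (hf : IsCubicGerm f α β δ) {c : ℝ} (hc0 : 0 < c)
    (hc1 : c ≤ 1 / 9) (hc2 : 9 * c ≤ 2 * α) {m : ℕ} {x y : ℕ → ℝ}
    (ho : IsBackwardOrbit f m x y) (hN : ∀ j ≤ m, scale (x j) (y j) ≤ δ)
    (hx : 0 ≤ x 0) (hy : y 0 ≤ 0) : m * scale (x 0) (y 0) ≤ 2 / c := by
  rcases (scale_nonneg (x 0) (y 0)).eq_or_lt with h0 | h0
  · rw [← h0]; simp; positivity
  have hsgn : ∀ j ≤ m, 0 ≤ x j ∧ y j ≤ 0 := by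
    intro j
    induction j with
    | zero => intro _; exact ⟨hx, hy⟩
    | succ j ih =>
      intro hj
      obtain ⟨h1, h2⟩ := ih (by omega)
      obtain ⟨e1, e2⟩ := ho j (by omega)
      have h3 : 0 ≤ x (j + 1) := by linarith
      have h4 := hf.nonneg h3 ((le_abs_self _).trans ((abs_le_scale _ _).trans (hN _ hj)))
      exact ⟨h3, by linarith⟩
  have hV := mul_le_of_quadratic_growth hc0 hc1 (L := m) (V := fun j => |x j| + √|y j|)
    (h0.trans_le (scale_le_add _ _)) ?_ ?_
  · refine le_trans ?_ hV
    gcongr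
    exact scale_le_add _ _
  · intro j hj
    obtain ⟨e1, e2⟩ := ho j hj
    obtain ⟨h1, h2⟩ := hsgn j hj.le
    obtain ⟨h3, h4⟩ := hsgn (j + 1) hj
    have hxd : x (j + 1) ≤ δ := (le_abs_self _).trans ((abs_le_scale _ _).trans (hN _ hj))
    have hl := hf.lower _ h3 hxd
    have : x j ^ 3 ≤ x (j + 1) ^ 3 := pow_le_pow_left₀ h1 (by linarith) 3
    have := mul_le_mul_of_nonneg_left this hf.alpha_pos.le
    simp only [abs_of_nonneg h1, abs_of_nonneg h3, abs_of_nonpos h2, abs_of_nonpos h4]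
    exact add_sqrt_growth hc0 hc1 hc2 h1 (by linarith [hf.delta_le]) (by linarith) (by linarith)
      (by linarith)
  · intro j hj
    have := hN j hj
    have := hf.delta_le
    linarith [add_le_two_mul_scale (x j) (y j)]

theorem time_le_of_nonpos_of_nonneg (hf : IsCubicGerm f α β δ) {c : ℝ} (hc0 : 0 < c)
    (hc1 : c ≤ 1 / 9) (hc2 : 9 * c ≤ 2 * α) {m : ℕ} {x y : ℕ → ℝ}
    (ho : IsBackwardOrbit f m x y) (hN : ∀ j ≤ m, scale (x j) (y j) ≤ δ)
    (hx : x 0 ≤ 0) (hy : 0 ≤ y 0) : m * scale (x 0) (y 0) ≤ 2 / c := by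
  have := hf.time_le_of_nonneg_of_nonpos hc0 hc1 hc2 (ho.neg hf.odd)
    (by simpa only [scale_neg] using hN) (by simpa using hx) (by simpa using hy)
  simpa only [scale_neg] using this

/-- An orbit just above the `x`-axis reaches it, in backward time, before `x` has halved. -/
theorem time_le_of_sector (hf : IsCubicGerm f α β δ) {c κ : ℝ} (hc0 : 0 < c)
    (hc1 : c ≤ 1 / 9) (hc2 : 9 * c ≤ 2 * α) (hκ0 : 0 < κ) (hκ1 : κ ≤ 1 / 4)
    (hκ2 : 32 * κ ^ 2 ≤ α) {m : ℕ} {x y : ℕ → ℝ}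
    (ho : IsBackwardOrbit f m x y) (hN : ∀ j ≤ m, scale (x j) (y j) ≤ δ)
    (hx : 0 < x 0) (hy : 0 < y 0) (hxy : y 0 ≤ κ * x 0 ^ 2) :
    m * scale (x 0) (y 0) ≤ 1 / (2 * κ) + 4 / c := by
  have hxd : ∀ j ≤ m, x j ≤ δ := fun j hj =>
    (le_abs_self _).trans ((abs_le_scale _ _).trans (hN _ hj))
  have hx1 : x 0 ≤ 1 := (hxd 0 (Nat.zero_le m)).trans hf.delta_le
  have hα := hf.alpha_pos
  have hs : scale (x 0) (y 0) = x 0 := by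
    refine le_antisymm (scale_le hx.le (abs_of_pos hx).le ?_) ?_
    · rw [abs_of_pos hy]; nlinarith
    · exact (le_abs_self _).trans (abs_le_scale _ _)
  rw [hs]
  -- a time at which the orbit would have crossed the axis
  obtain ⟨J, hJ1, hJ2⟩ : ∃ J : ℕ, 1 ≤ 4 * κ * x 0 * J ∧ 2 * κ * x 0 * J ≤ 1 := by
    have hp : 0 < 4 * κ * x 0 := by positivity
    refine ⟨⌈1 / (4 * κ * x 0)⌉₊, ?_, ?_⟩
    · have := Nat.le_ceil (1 / (4 * κ * x 0))
      rw [div_le_iff₀ hp] at this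
      linarith
    · have := (Nat.ceil_lt_add_one (a := 1 / (4 * κ * x 0)) (by positivity)).le
      have h2 := mul_le_mul_of_nonneg_left this hp.le
      rw [mul_add, mul_one_div_cancel hp.ne'] at h2
      nlinarith
  have key : ∀ j, j ≤ m → j ≤ J → (∀ i < j, 0 < y i) →
      x 0 - j * (κ * x 0 ^ 2) ≤ x j ∧ x 0 / 2 ≤ x j ∧ y j ≤ y 0 - j * (α * x 0 ^ 3 / 8) := by
    intro j
    induction j with
    | zero => intro _ _ _; refine ⟨by simp, by linarith, by simp⟩
    | succ j ih =>
      intro hjm hjJ hpos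
      obtain ⟨h1, -, h2⟩ := ih (by omega) (by omega) fun i hi => hpos i (by omega)
      obtain ⟨e1, e2⟩ := ho j (by omega)
      have h3 : y j ≤ κ * x 0 ^ 2 := by
        have : 0 ≤ (j : ℝ) * (α * x 0 ^ 3 / 8) := by positivity
        linarith
      have h4 : x 0 - ((j + 1 : ℕ) : ℝ) * (κ * x 0 ^ 2) ≤ x (j + 1) := by
        push_cast; linarith
      have h5 : x 0 / 2 ≤ x (j + 1) := by
        have hc : ((j + 1 : ℕ) : ℝ) ≤ J := by exact_mod_cast hjJ
        have : ((j + 1 : ℕ) : ℝ) * (κ * x 0 ^ 2) ≤ J * (κ * x 0 ^ 2) := by gcongr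
        nlinarith
      refine ⟨h4, h5, ?_⟩
      have h6 := hf.lower (x (j + 1)) (by linarith) (hxd _ hjm)
      have h7 : (x 0 / 2) ^ 3 ≤ x (j + 1) ^ 3 := pow_le_pow_left₀ (by linarith) h5 3
      have h8 := mul_le_mul_of_nonneg_left h7 hα.le
      push_cast
      nlinarith
  by_cases hcr : ∃ j, j ≤ m ∧ j ≤ J ∧ y j ≤ 0
  · classical
    obtain ⟨hj1, hj2, hj3⟩ := Nat.find_spec hcr
    set j := Nat.find hcr with hjdef
    have hpos : ∀ i < j, 0 < y i := by
      intro i hi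
      have := Nat.find_min hcr hi
      by_contra hc
      exact this ⟨by omega, by omega, not_lt.1 hc⟩
    obtain ⟨-, h1, -⟩ := key j hj1 hj2 hpos
    have h2 := hf.time_le_of_nonneg_of_nonpos hc0 hc1 hc2 (ho.shift j)
      (fun i hi => hN _ (by omega)) (by simp; linarith) (by simpa using hj3)
    simp only [add_zero] at h2
    have h3 : x 0 / 2 ≤ scale (x j) (y j) := h1.trans ((le_abs_self _).trans (abs_le_scale _ _))
    have h4 : ((m - j : ℕ) : ℝ) * (x 0 / 2) ≤ 2 / c := le_trans (by gcongr) h2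
    have h5 : (j : ℝ) * x 0 ≤ 1 / (2 * κ) := by
      rw [le_div_iff₀ (by positivity)]
      have : (j : ℝ) ≤ J := by exact_mod_cast hj2
      have : 2 * κ * x 0 * j ≤ 2 * κ * x 0 * J := by gcongr
      linarith
    rw [Nat.cast_sub hj1] at h4
    have : 4 / c = 2 * (2 / c) := by ring
    rw [this]
    linarith
  · push Not at hcr
    have hmJ : m < J := by
      by_contra hc
      obtain ⟨-, -, h1⟩ := key J (not_lt.1 hc) le_rfl fun i hi => hcr i (by omega) (by omega)
      have h2 := hcr J (not_lt.1 hc) le_rfl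
      have h3 : κ * x 0 ^ 2 ≤ J * (α * x 0 ^ 3 / 8) := by
        have h4 : 32 * κ ^ 2 * (x 0 ^ 3 * J) ≤ α * (x 0 ^ 3 * J) := by gcongr
        have h5 : 4 * κ * x 0 ^ 2 * 1 ≤ 4 * κ * x 0 ^ 2 * (4 * κ * x 0 * J) := by gcongr
        nlinarith
      linarith
    have h5 : (m : ℝ) * x 0 ≤ 1 / (2 * κ) := by
      rw [le_div_iff₀ (by positivity)]
      have : (m : ℝ) ≤ J := by exact_mod_cast hmJ.le
      have : 2 * κ * x 0 * m ≤ 2 * κ * x 0 * J := by gcongr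
      linarith
    have : 0 < 4 / c := by positivity
    linarith

/-- Outside the region `x > 0, κ x² ≤ y` (and its mirror image) the backward orbit leaves within a
time `O(1 / scale)`. -/
theorem time_le_of_not_mem (hf : IsCubicGerm f α β δ) {c κ : ℝ} (hc0 : 0 < c)
    (hc1 : c ≤ 1 / 9) (hc2 : 9 * c ≤ 2 * α) (hκ0 : 0 < κ) (hκ1 : κ ≤ 1 / 4)
    (hκ2 : 32 * κ ^ 2 ≤ α) {m : ℕ} {x y : ℕ → ℝ}
    (ho : IsBackwardOrbit f m x y) (hN : ∀ j ≤ m, scale (x j) (y j) ≤ δ)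
    (hxy : 0 ≤ x 0 ∨ 0 ≤ y 0) (hn : ¬(0 < x 0 ∧ κ * x 0 ^ 2 ≤ y 0)) :
    m * scale (x 0) (y 0) ≤ 1 / (2 * κ) + 4 / c := by
  have hle : 2 / c ≤ 1 / (2 * κ) + 4 / c := by
    have h1 : 2 / c ≤ 4 / c := by gcongr; norm_num
    have h2 : 0 < 1 / (2 * κ) := by positivity
    linarith
  rcases le_or_gt (x 0) 0 with hx | hx
  · rcases le_total 0 (y 0) with hy | hy
    · exact (hf.time_le_of_nonpos_of_nonneg hc0 hc1 hc2 ho hN hx hy).trans hle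
    · rcases hxy with h | h
      · exact (hf.time_le_of_nonneg_of_nonpos hc0 hc1 hc2 ho hN h hy).trans hle
      · exact (hf.time_le_of_nonpos_of_nonneg hc0 hc1 hc2 ho hN hx h).trans hle
  · rcases le_or_gt (y 0) 0 with hy | hy
    · exact (hf.time_le_of_nonneg_of_nonpos hc0 hc1 hc2 ho hN hx.le hy).trans hle
    · refine hf.time_le_of_sector hc0 hc1 hc2 hκ0 hκ1 hκ2 ho hN hx hy ?_
      by_contra hc
      exact hn ⟨hx, (not_le.1 hc).le⟩

/-- In the quadrant `x, y ≥ 0` a backward orbit approaches the origin at quadratic speed, so that it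
takes a time `O(1 / scale)` to get to a given scale. -/
theorem time_le_of_quadrant (hf : IsCubicGerm f α β δ) {c : ℝ} (hc0 : 0 < c)
    (hc1 : c ≤ 1 / 9) (hc2 : 9 * c ≤ 2 * α) {k : ℕ} {x y : ℕ → ℝ}
    (ho : IsBackwardOrbit f k x y) (hN : ∀ j ≤ k, scale (x j) (y j) ≤ δ)
    (hpos : ∀ j ≤ k, 0 ≤ x j ∧ 0 ≤ y j) : k * scale (x k) (y k) ≤ 2 / c := by
  rcases (scale_nonneg (x k) (y k)).eq_or_lt with h0 | h0
  · rw [← h0]; simp; positivity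
  have hV := mul_le_of_quadratic_growth hc0 hc1 (L := k)
    (V := fun i => |x (k - i)| + √|y (k - i)|)
    (by simpa using h0.trans_le (scale_le_add _ _)) ?_ ?_
  · refine le_trans ?_ hV
    gcongr
    simpa using scale_le_add _ _
  · intro i hi
    have e : k - i = (k - (i + 1)) + 1 := by omega
    simp only [e]
    set j := k - (i + 1)
    have hj : j < k := by omega
    obtain ⟨e1, e2⟩ := ho j hj
    obtain ⟨h1, h2⟩ := hpos j hj.le
    obtain ⟨h3, h4⟩ := hpos (j + 1) hj
    have hxd : x (j + 1) ≤ δ := (le_abs_self _).trans ((abs_le_scale _ _).trans (hN _ hj))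
    have hl := hf.lower _ h3 hxd
    simp only [abs_of_nonneg h1, abs_of_nonneg h3, abs_of_nonneg h2, abs_of_nonneg h4]
    have := hf.nonneg h3 hxd
    exact add_sqrt_growth hc0 hc1 hc2 h3 (by linarith [hf.delta_le]) h4 (by linarith)
      (by linarith)
  · intro j hj
    have := hN (k - j) (by omega)
    have := hf.delta_le
    linarith [add_le_two_mul_scale (x (k - j)) (y (k - j))]

end IsCubicGerm

/-! ### Expansion along local orbits -/

namespace IsCubicGerm

variable {f : ℝ → ℝ} {α β δ : ℝ}

theorem deriv_neg_eq (hf : IsCubicGerm f α β δ) (t : ℝ) : deriv f (-t) = deriv f t := by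
  have h1 : (fun s => f (-s)) = fun s => -f s := funext hf.odd
  have h2 := congrArg (fun g => deriv g t) h1
  simp only [deriv_comp_neg, deriv.fun_neg] at h2
  linarith

/-- The discrete Wronskian of the tangent orbit and of the increments `y` of the orbit. By convexity
of `f`, the sequence `y` satisfies `y (j - 1) - 2 y j + y (j + 1) ≤ q j * y j`, with equality for
`a`; so the Wronskian can only decrease forward in time. -/
theorem wronskian_le (hf : IsCubicGerm f α β δ) {k : ℕ} {x y a b : ℕ → ℝ}
    (ho : IsBackwardOrbit f (k + 1) x y)
    (ht : IsTangentOrbit (fun j => deriv f (x j)) (k + 1) a b)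
    (hpos : ∀ j ≤ k + 1, 0 ≤ x j ∧ 0 ≤ y j) (hxd : ∀ j ≤ k + 1, x j ≤ δ)
    (ha : 0 < a (k + 1)) (hb : 0 ≤ b (k + 1)) {j : ℕ} (hj : j ≤ k) :
    y j * a (j + 1) - a j * y (j + 1) ≤ f (x (k + 1)) * a (k + 1) := by
  have hq : ∀ j, 0 ≤ deriv f (x j) := fun j => hf.deriv_nonneg _
  induction hj using Nat.decreasingInduction with
  | of_succ i hi ih =>
    refine le_trans ?_ ih
    obtain ⟨e1, e2⟩ := ho i (by omega)
    obtain ⟨e3, e4⟩ := ho (i + 1) (by omega)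
    obtain ⟨t1, t2⟩ := ht i (by omega)
    obtain ⟨t3, t4⟩ := ht (i + 1) (by omega)
    have h1 := hf.tangent (x (i + 1)) (x (i + 1 + 1)) (hpos _ (by omega)).1
      (by linarith [(hpos (i + 1) (by omega)).2]) (hxd _ (by omega))
    have h2 : x (i + 1) - x (i + 1 + 1) = y (i + 1) := by linarith
    rw [h2] at h1
    have h3 := (ht.pos hq ha hb (j := i + 1) (by omega)).1.le
    have ey : y i ≤ 2 * y (i + 1) - y (i + 1 + 1) + deriv f (x (i + 1)) * y (i + 1) := by
      linarith
    have ea : a i = 2 * a (i + 1) - a (i + 1 + 1) + deriv f (x (i + 1)) * a (i + 1) := by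
      linarith
    rw [ea]
    have := mul_le_mul_of_nonneg_right ey h3
    linarith
  | self =>
    obtain ⟨e1, e2⟩ := ho k (by omega)
    obtain ⟨t1, t2⟩ := ht k (by omega)
    have h1 := (ht.pos hq ha hb (j := k) (by omega)).2
    have h2 := (hpos (k + 1) le_rfl).2
    have ey : y k = y (k + 1) + f (x (k + 1)) := by linarith
    rw [ey, t2]
    nlinarith [mul_nonneg h1 h2]

/-- In the region `x > 0, κ x² ≤ y` tangent vectors grow at least like `y`, up to a constant. -/
theorem mul_scale_sq_le (hf : IsCubicGerm f α β δ) {κ B : ℝ} (hκ0 : 0 < κ) (hκ1 : κ ≤ 1)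
    {k : ℕ} {x y a b : ℕ → ℝ} (ho : IsBackwardOrbit f k x y)
    (hN : ∀ j ≤ k, scale (x j) (y j) ≤ δ)
    (ht : IsTangentOrbit (fun j => deriv f (x j)) k a b)
    (hQ : ∀ j ≤ k, 0 < x j ∧ κ * x j ^ 2 ≤ y j)
    (ha : 0 < a k) (hb : 0 ≤ b k) (hk : k * scale (x k) (y k) ≤ B) :
    κ * Real.exp (-(β / κ * B)) * scale (x 0) (y 0) ^ 2 * a k
      ≤ a 0 * scale (x k) (y k) ^ 2 := by
  have hβ := hf.beta_pos
  have hq : ∀ j, 0 ≤ deriv f (x j) := fun j => hf.deriv_nonneg _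
  have hxd : ∀ j ≤ k, x j ≤ δ := fun j hj =>
    (le_abs_self _).trans ((abs_le_scale _ _).trans (hN _ hj))
  have hy : ∀ j ≤ k, 0 < y j := fun j hj =>
    lt_of_lt_of_le (mul_pos hκ0 (pow_pos (hQ j hj).1 2)) (hQ j hj).2
  have hpos : ∀ j ≤ k, 0 ≤ x j ∧ 0 ≤ y j := fun j hj => ⟨(hQ j hj).1.le, (hy j hj).le⟩
  set θ := β / κ * x k with hθ
  have hθ0 : 0 ≤ θ := by have := (hQ k le_rfl).1; positivity
  have hymono : ∀ j ≤ k, y k ≤ y j := by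
    intro j hj
    induction hj using Nat.decreasingInduction with
    | of_succ i hi ih =>
      obtain ⟨e1, e2⟩ := ho i hi
      have := hf.nonneg (hpos (i + 1) hi).1 (hxd _ hi)
      linarith
    | self => exact le_rfl
  have hfk : f (x k) ≤ θ * y k := by
    refine (hf.upper _ (hpos k le_rfl).1 (hxd k le_rfl)).trans ?_
    calc β * x k ^ 3 = θ * (κ * x k ^ 2) := by rw [hθ]; field_simp
      _ ≤ θ * y k := by gcongr; exact (hQ k le_rfl).2
  have hstep : ∀ j < k, y j * a (j + 1) ≤ (1 + θ) * (a j * y (j + 1)) := by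
    intro j hj
    obtain ⟨l, rfl⟩ : ∃ l, k = l + 1 := ⟨k - 1, by omega⟩
    have h1 := hf.wronskian_le ho ht hpos hxd ha hb (j := j) (by omega)
    have h2 := (ht.antitone hq ha hb (i := j) (j := l + 1) (by omega) le_rfl).1
    have h3 := hymono (j + 1) hj
    have h4 : f (x (l + 1)) * a (l + 1) ≤ θ * y (l + 1) * a (l + 1) := by gcongr
    have h5 : θ * y (l + 1) * a (l + 1) ≤ θ * y (j + 1) * a j := by
      have := hy (j + 1) hj
      gcongr
    linarith
  have key : ∀ j ≤ k, y j * a k ≤ (1 + θ) ^ (k - j) * (y k * a j) := by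
    intro j hj
    induction hj using Nat.decreasingInduction with
    | of_succ i hi ih =>
      have h1 := hstep i hi
      have h2 := (ht.pos hq ha hb (j := i + 1) hi).1
      have h3 := (ht.pos hq ha hb (j := i) hi.le).1
      have e : k - i = (k - (i + 1)) + 1 := by omega
      rw [e, pow_succ]
      set P := (1 + θ) ^ (k - (i + 1))
      refine le_of_mul_le_mul_right ?_ h2
      calc y i * a k * a (i + 1) = (y i * a (i + 1)) * a k := by ring
        _ ≤ ((1 + θ) * (a i * y (i + 1))) * a k := by gcongr
        _ = (1 + θ) * a i * (y (i + 1) * a k) := by ring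
        _ ≤ (1 + θ) * a i * (P * (y k * a (i + 1))) := by gcongr
        _ = P * (1 + θ) * (y k * a i) * a (i + 1) := by ring
    | self => simp
  have h0 := key 0 (Nat.zero_le k)
  have ha0 := (ht.pos hq ha hb (j := 0) (Nat.zero_le k)).1
  have hexp : (1 + θ) ^ k ≤ Real.exp (β / κ * B) := by
    calc (1 + θ) ^ k ≤ Real.exp θ ^ k := by
          gcongr; linarith [Real.add_one_le_exp θ]
      _ = Real.exp (k * θ) := (Real.exp_nat_mul θ k).symm
      _ ≤ Real.exp (β / κ * B) := by
          apply Real.exp_le_exp.2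
          have h1 : x k ≤ scale (x k) (y k) := (le_abs_self _).trans (abs_le_scale _ _)
          calc k * θ = β / κ * (k * x k) := by rw [hθ]; ring
            _ ≤ β / κ * (k * scale (x k) (y k)) := by gcongr
            _ ≤ β / κ * B := by gcongr
  have hs0 : κ * scale (x 0) (y 0) ^ 2 ≤ y 0 := by
    obtain ⟨h1, h2⟩ := hQ 0 (Nat.zero_le k)
    have h3 := hy 0 (Nat.zero_le k)
    rcases max_choice |x 0| √|y 0| with h | h
    · rw [scale, h, sq_abs]; exact h2
    · rw [scale, h, Real.sq_sqrt (abs_nonneg _), abs_of_pos h3]; nlinarith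
  have hsk : y k ≤ scale (x k) (y k) ^ 2 := (le_abs_self _).trans (abs_le_scale_sq _ _)
  have hE := Real.exp_pos (β / κ * B)
  have hmain : κ * scale (x 0) (y 0) ^ 2 * a k
      ≤ Real.exp (β / κ * B) * (scale (x k) (y k) ^ 2 * a 0) := by
    calc κ * scale (x 0) (y 0) ^ 2 * a k ≤ y 0 * a k := by gcongr
      _ ≤ (1 + θ) ^ k * (y k * a 0) := by simpa using h0
      _ ≤ Real.exp (β / κ * B) * (scale (x k) (y k) ^ 2 * a 0) := by
          have := hy k le_rfl
          gcongr
  calc κ * Real.exp (-(β / κ * B)) * scale (x 0) (y 0) ^ 2 * a k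
      = Real.exp (-(β / κ * B)) * (κ * scale (x 0) (y 0) ^ 2 * a k) := by ring
    _ ≤ Real.exp (-(β / κ * B)) * (Real.exp (β / κ * B) * (scale (x k) (y k) ^ 2 * a 0)) := by
        gcongr
    _ = a 0 * scale (x k) (y k) ^ 2 := by
        rw [← mul_assoc, ← Real.exp_add]; simp [mul_comm]

/-- A local orbit has a moment `k` at which its scale is `O(1 / m)`, and from which on tangent
vectors have grown like the square of the scale. -/
theorem exists_turning_time (hf : IsCubicGerm f α β δ) :
    ∃ B d : ℝ, 0 < B ∧ 0 < d ∧ ∀ (m : ℕ) (x y a b : ℕ → ℝ), IsBackwardOrbit f m x y →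
      (∀ j ≤ m, scale (x j) (y j) ≤ δ) →
      IsTangentOrbit (fun j => deriv f (x j)) m a b → 0 < a m → 0 ≤ b m →
      ∃ k ≤ m, m * scale (x k) (y k) ≤ B ∧
        d * scale (x 0) (y 0) ^ 2 * a k ≤ a 0 * scale (x k) (y k) ^ 2 := by
  obtain ⟨c, hc0, hc1, hc2⟩ := exists_rate hf.alpha_pos
  obtain ⟨κ, hκ0, hκ1, hκ2⟩ : ∃ κ : ℝ, 0 < κ ∧ κ ≤ 1 / 4 ∧ 32 * κ ^ 2 ≤ α := by
    have hα := hf.alpha_pos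
    refine ⟨min (1 / 4) (α / 8), by positivity, min_le_left _ _, ?_⟩
    have h0 : 0 < min (1 / 4) (α / 8) := by positivity
    have h1 := min_le_left (1 / 4) (α / 8)
    have h2 := min_le_right (1 / 4) (α / 8)
    nlinarith
  have hβ := hf.beta_pos
  set B₁ := 1 / (2 * κ) + 4 / c with hB₁
  have hB₁0 : 0 < B₁ := by positivity
  set d := κ * Real.exp (-(β / κ * (2 / c))) with hd
  have hd0 : 0 < d := by positivity
  have hd1 : d ≤ 1 := by
    have : Real.exp (-(β / κ * (2 / c))) ≤ 1 := by
      apply Real.exp_le_one_iff.2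
      have : 0 < β / κ * (2 / c) := by positivity
      linarith
    calc d ≤ 1 / 4 * 1 := by rw [hd]; gcongr
      _ ≤ 1 := by norm_num
  have hcB : 2 / c ≤ 2 / c + 2 * B₁ + 1 := by linarith
  refine ⟨2 / c + 2 * B₁ + 1, d, by positivity, hd0, ?_⟩
  -- it suffices to treat `x 0 ≥ 0`, by the symmetry of the map
  suffices H : ∀ (m : ℕ) (x y a b : ℕ → ℝ), 0 ≤ x 0 → IsBackwardOrbit f m x y →
      (∀ j ≤ m, scale (x j) (y j) ≤ δ) →
      IsTangentOrbit (fun j => deriv f (x j)) m a b → 0 < a m → 0 ≤ b m →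
      ∃ k ≤ m, m * scale (x k) (y k) ≤ 2 / c + 2 * B₁ + 1 ∧
        d * scale (x 0) (y 0) ^ 2 * a k ≤ a 0 * scale (x k) (y k) ^ 2 by
    intro m x y a b ho hN ht ha hb
    rcases le_total 0 (x 0) with h | h
    · exact H m x y a b h ho hN ht ha hb
    · have := H m (fun j => -x j) (fun j => -y j) a b (by simpa using h) (ho.neg hf.odd)
        (by simpa only [scale_neg] using hN) (by simpa only [hf.deriv_neg_eq] using ht) ha hb
      simpa only [scale_neg] using this
  intro m x y a b hx ho hN ht ha hb
  have hq : ∀ j, 0 ≤ deriv f (x j) := fun j => hf.deriv_nonneg _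
  by_cases hall : ∀ j ≤ m, 0 < x j ∧ κ * x j ^ 2 ≤ y j
  · have hpos : ∀ j ≤ m, 0 ≤ x j ∧ 0 ≤ y j := fun j hj =>
      ⟨(hall j hj).1.le, (mul_nonneg hκ0.le (sq_nonneg _)).trans (hall j hj).2⟩
    have htime := hf.time_le_of_quadrant hc0 hc1 hc2 ho hN hpos
    exact ⟨m, le_rfl, htime.trans hcB,
      hf.mul_scale_sq_le hκ0 (by linarith) ho hN ht hall ha hb htime⟩
  · classical
    simp only [not_forall] at hall
    have hex : ∃ j, ∃ _ : j ≤ m, ¬(0 < x j ∧ κ * x j ^ 2 ≤ y j) := hall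
    obtain ⟨hjm, hjQ⟩ := Nat.find_spec hex
    have hmin : ∀ i < Nat.find hex, 0 < x i ∧ κ * x i ^ 2 ≤ y i := by
      intro i hi
      have := Nat.find_min hex hi
      by_contra hc
      exact this ⟨by omega, hc⟩
    generalize Nat.find hex = i at hjm hjQ hmin
    cases i with
    | zero =>
      refine ⟨0, Nat.zero_le m, ?_, ?_⟩
      · have := hf.time_le_of_not_mem hc0 hc1 hc2 hκ0 hκ1 hκ2 ho hN (Or.inl hx) hjQ
        have : 0 < 2 / c := by positivity
        linarith
      · have ha0 := (ht.pos hq ha hb (Nat.zero_le m)).1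
        have : 0 ≤ scale (x 0) (y 0) ^ 2 * a 0 := by positivity
        nlinarith
    | succ k =>
      have hQ : ∀ j ≤ k, 0 < x j ∧ κ * x j ^ 2 ≤ y j := fun j hj => hmin j (by omega)
      have hpos : ∀ j ≤ k, 0 ≤ x j ∧ 0 ≤ y j := fun j hj =>
        ⟨(hQ j hj).1.le, (mul_nonneg hκ0.le (sq_nonneg _)).trans (hQ j hj).2⟩
      have ho' : IsBackwardOrbit f k x y := fun j hj => ho j (by omega)
      obtain ⟨e1, e2⟩ := ho k (by omega)
      have htime := hf.time_le_of_quadrant hc0 hc1 hc2 ho' (fun j hj => hN j (by omega)) hpos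
      have hsgn : 0 ≤ x (k + 1) ∨ 0 ≤ y (k + 1) := by
        rcases le_total 0 (x (k + 1)) with h | h
        · exact Or.inl h
        · right
          have h1 : -x (k + 1) ≤ δ := (neg_le_abs _).trans ((abs_le_scale _ _).trans (hN _ hjm))
          have h2 := hf.nonneg (x := -x (k + 1)) (by linarith) h1
          rw [hf.odd] at h2
          linarith [(hpos k le_rfl).2]
      have hrest := hf.time_le_of_not_mem hc0 hc1 hc2 hκ0 hκ1 hκ2 (ho.shift (k + 1))
        (fun j hj => hN _ (by omega)) (by simpa using hsgn) (by simpa using hjQ)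
      simp only [add_zero] at hrest
      have hcmp := hf.scale_le_two_mul e1 e2 (hN _ hjm)
      have hkpos := ht.pos hq ha hb (j := k) (by omega)
      refine ⟨k, by omega, ?_, ?_⟩
      · have hm : (m : ℝ) = k + 1 + ((m - (k + 1) : ℕ) : ℝ) := by
          rw [Nat.cast_sub hjm]; push_cast; ring
        have h1 : ((m - (k + 1) : ℕ) : ℝ) * scale (x k) (y k) ≤
            ((m - (k + 1) : ℕ) : ℝ) * (2 * scale (x (k + 1)) (y (k + 1))) := by gcongr
        have h2 : scale (x k) (y k) ≤ 1 := (hN k (by omega)).trans hf.delta_le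
        rw [hm, add_mul, add_mul, one_mul]
        linarith
      · exact hf.mul_scale_sq_le hκ0 (by linarith) ho' (fun j hj => hN j (by omega))
          (ht.mono (by omega)) hQ hkpos.1 hkpos.2 htime

/-- Quadratic expansion along orbits that stay near the fixed point. -/
theorem local_expansion (hf : IsCubicGerm f α β δ) {c₁ : ℝ} (hc₁ : 0 < c₁) :
    ∃ ε : ℝ, 0 < ε ∧ ∀ (m : ℕ) (x y a b : ℕ → ℝ), IsBackwardOrbit f m x y →
      (∀ j ≤ m, scale (x j) (y j) ≤ δ) →
      IsTangentOrbit (fun j => deriv f (x j)) m a b → 0 < a m →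
      c₁ * scale (x m) (y m) * a m ≤ b m →
      (1 + ε * scale (x 0) (y 0) * m) ^ 2 * a m ≤ a 0 := by
  obtain ⟨B, d, hB, hd, H⟩ := hf.exists_turning_time
  have hβ := hf.beta_pos
  have hD : 0 < √d := Real.sqrt_pos.2 hd
  have hD2 := Real.sq_sqrt hd.le
  set D := √d
  -- times `m ≤ B₂ / scale` are handled by the linear growth of `a`, longer ones by the turning time
  set B₂ := 2 * B / D with hB₂
  have hB₂0 : 0 < B₂ := by positivity
  set G := 1 + (1 + β) * B₂ with hG
  have hG0 : 0 < G := by positivity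
  set ε := min (D / (2 * B)) (min 1 (c₁ / G / (2 + B₂))) with hε
  have hε0 : 0 < ε := by positivity
  have hε1 : ε ≤ D / (2 * B) := min_le_left _ _
  have hε2 : ε ≤ 1 := (min_le_right _ _).trans (min_le_left _ _)
  have hε3 : ε * (2 + B₂) ≤ c₁ / G := by
    rw [← le_div_iff₀ (by positivity)]
    exact (min_le_right _ _).trans (min_le_right _ _)
  refine ⟨ε, hε0, ?_⟩
  intro m x y a b ho hN ht ha hb
  have hq : ∀ j, 0 ≤ deriv f (x j) := fun j => hf.deriv_nonneg _
  have hb0 : 0 ≤ b m := le_trans (by have := scale_nonneg (x m) (y m); positivity) hb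
  have hlin := ht.add_mul_le hq ha hb0
  have hN0 := scale_nonneg (x 0) (y 0)
  obtain ⟨t, ht_def⟩ : ∃ t, t = scale (x 0) (y 0) * m := ⟨_, rfl⟩
  have ht0 : 0 ≤ t := by rw [ht_def]; positivity
  rw [mul_assoc, ← ht_def]
  rcases le_total t B₂ with h | h
  · have h1 : t * c₁ / G ≤ m * (c₁ * scale (x m) (y m)) := by
      rcases hN0.eq_or_lt with h0 | h0
      · rw [ht_def, ← h0]
        have := scale_nonneg (x m) (y m)
        simp only [zero_mul, zero_div]
        positivity
      · obtain ⟨h2, h3⟩ := hf.inv_scale_le ho hN h0 le_rfl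
        have h4 : scale (x 0) (y 0) ≤ G * scale (x m) (y m) := by
          have h5 := mul_le_mul_of_nonneg_right h3 (mul_nonneg h0.le h2.le)
          have e1 : (scale (x m) (y m))⁻¹ * (scale (x 0) (y 0) * scale (x m) (y m))
              = scale (x 0) (y 0) := by field_simp
          have e2 : ((scale (x 0) (y 0))⁻¹ + (1 + β) * m) *
              (scale (x 0) (y 0) * scale (x m) (y m))
              = (1 + (1 + β) * t) * scale (x m) (y m) := by rw [ht_def]; field_simp
          rw [e1, e2] at h5
          refine h5.trans ?_
          rw [hG]
          gcongr
        rw [div_le_iff₀ hG0, ht_def]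
        have : (0 : ℝ) ≤ m * c₁ := by positivity
        nlinarith
    have h2 : (1 + ε * t) ^ 2 ≤ 1 + t * c₁ / G := by
      have h3 : ε * t ≤ B₂ := by nlinarith
      have h4 : ε * (2 + B₂) * t ≤ c₁ / G * t := by gcongr
      have e : t * c₁ / G = c₁ / G * t := by ring
      have h5 : ε * t * (ε * t) ≤ ε * t * B₂ := by gcongr
      rw [e]
      nlinarith
    calc (1 + ε * t) ^ 2 * a m ≤ (1 + t * c₁ / G) * a m := by gcongr
      _ ≤ (1 + m * (c₁ * scale (x m) (y m))) * a m := by gcongr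
      _ = a m + m * (c₁ * scale (x m) (y m) * a m) := by ring
      _ ≤ a m + m * b m := by gcongr
      _ ≤ a 0 := hlin
  · obtain ⟨k, hk, h1, h2⟩ := H m x y a b ho hN ht ha hb0
    have h3 := (ht.antitone hq ha hb0 hk le_rfl).1
    have ha0 := (ht.pos hq ha hb0 (Nat.zero_le m)).1
    have hNk := scale_nonneg (x k) (y k)
    have h4 : d * t ^ 2 * a m ≤ a 0 * B ^ 2 := by
      calc d * t ^ 2 * a m ≤ d * t ^ 2 * a k := by gcongr
        _ = (d * scale (x 0) (y 0) ^ 2 * a k) * (m : ℝ) ^ 2 := by rw [ht_def]; ring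
        _ ≤ (a 0 * scale (x k) (y k) ^ 2) * (m : ℝ) ^ 2 := by gcongr
        _ = a 0 * (m * scale (x k) (y k)) ^ 2 := by ring
        _ ≤ a 0 * B ^ 2 := by gcongr
    have h5 : 1 + ε * t ≤ D * t / B := by
      have h6 : 1 ≤ D / (2 * B) * t := by
        calc (1 : ℝ) = D / (2 * B) * B₂ := by rw [hB₂]; field_simp
          _ ≤ D / (2 * B) * t := by gcongr
      have h7 : ε * t ≤ D / (2 * B) * t := by gcongr
      have e : D * t / B = D / (2 * B) * t + D / (2 * B) * t := by field_simp; ring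
      rw [e]
      linarith
    calc (1 + ε * t) ^ 2 * a m ≤ (D * t / B) ^ 2 * a m := by gcongr
      _ = d * t ^ 2 * a m / B ^ 2 := by rw [← hD2]; field_simp
      _ ≤ a 0 := by rw [div_le_iff₀ (by positivity)]; exact h4

end IsCubicGerm

/-! ### The circle map near its neutral fixed point -/

theorem exists_int_of_coe_eq {s t : ℝ} (h : (s : UnitAddCircle) = (t : UnitAddCircle)) :
    ∃ k : ℤ, s - t = k := by
  have h' : ((s - t : ℝ) : UnitAddCircle) = 0 := by simp [h]
  obtain ⟨m, hm⟩ := (AddCircle.coe_eq_zero_iff (1 : ℝ)).1 h'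
  exact ⟨m, by simpa using hm.symm⟩

theorem coe_int_add (k : ℤ) (t : ℝ) : ((t + k : ℝ) : UnitAddCircle) = (t : UnitAddCircle) := by
  simp

theorem eq_of_forall_coe_eq_zero {g : ℝ → ℝ} (hg : Continuous g)
    (h : ∀ t, (g t : UnitAddCircle) = 0) (s t : ℝ) : g s = g t := by
  have hdisc : IsDiscrete (Set.range (Int.cast : ℤ → ℝ)) := by
    rw [isDiscrete_iff_discreteTopology]
    exact Int.isClosedEmbedding_coe_real.isEmbedding.toHomeomorph.discreteTopology_iff.1 inferInstance
  refine isPreconnected_univ.constant_of_mapsTo hdisc hg.continuousOn (fun r _ => ?_)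
    (Set.mem_univ s) (Set.mem_univ t)
  obtain ⟨k, hk⟩ := exists_int_of_coe_eq (s := g r) (t := 0) (by simpa using h r)
  exact ⟨k, by simpa using hk.symm⟩

theorem nonneg_of_deriv_nonneg_Icc {g : ℝ → ℝ} {δ : ℝ} (hg : Differentiable ℝ g) (h0 : 0 ≤ g 0)
    (h : ∀ x, 0 ≤ x → x ≤ δ → 0 ≤ deriv g x) {x : ℝ} (hx : 0 ≤ x) (hxδ : x ≤ δ) : 0 ≤ g x := by
  have hm : MonotoneOn g (Set.Icc 0 δ) := by
    refine monotoneOn_of_deriv_nonneg (convex_Icc 0 δ) hg.continuous.continuousOn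
      hg.differentiableOn fun y hy => ?_
    rw [interior_Icc] at hy
    exact h y hy.1.le hy.2.le
  exact h0.trans (hm ⟨le_rfl, hx.trans hxδ⟩ ⟨hx, hxδ⟩ hx)

/-- A lower bound for the third derivative of a function with vanishing 2-jet integrates to a cubic
lower bound. -/
theorem cubic_lower_of_deriv {g : ℝ → ℝ} {δ t : ℝ} (hg : ContDiff ℝ ∞ g) (h0 : g 0 = 0)
    (h1 : deriv g 0 = 0) (h2 : deriv (deriv g) 0 = 0)
    (h3 : ∀ x, 0 ≤ x → x ≤ δ → 6 * t ≤ deriv (deriv (deriv g)) x) {x : ℝ} (hx : 0 ≤ x)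
    (hxδ : x ≤ δ) :
    t * x ^ 3 ≤ g x ∧ 3 * t * x ^ 2 ≤ deriv g x ∧ 6 * t * x ≤ deriv (deriv g) x := by
  have c1 : ContDiff ℝ ∞ (deriv g) := (contDiff_infty_iff_deriv.1 hg).2
  have c2 : ContDiff ℝ ∞ (deriv (deriv g)) := (contDiff_infty_iff_deriv.1 c1).2
  have d0 : Differentiable ℝ g := hg.differentiable (by simp)
  have d1 : Differentiable ℝ (deriv g) := c1.differentiable (by simp)
  have d2 : Differentiable ℝ (deriv (deriv g)) := c2.differentiable (by simp)
  have k2 : ∀ x, 0 ≤ x → x ≤ δ → 6 * t * x ≤ deriv (deriv g) x := by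
    intro x hx hxδ
    have := nonneg_of_deriv_nonneg_Icc (g := fun x => deriv (deriv g) x - 6 * t * x) (δ := δ)
      (by fun_prop) (by simp [h2]) (fun y hy hyδ => ?_) hx hxδ
    · linarith
    · have e : HasDerivAt (fun x => deriv (deriv g) x - 6 * t * x)
          (deriv (deriv (deriv g)) y - 6 * t * 1) y :=
        (d2 y).hasDerivAt.sub ((hasDerivAt_id y).const_mul (6 * t))
      rw [e.deriv]
      linarith [h3 y hy hyδ]
  have k1 : ∀ x, 0 ≤ x → x ≤ δ → 3 * t * x ^ 2 ≤ deriv g x := by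
    intro x hx hxδ
    have := nonneg_of_deriv_nonneg_Icc (g := fun x => deriv g x - 3 * t * x ^ 2) (δ := δ)
      (by fun_prop) (by simp [h1]) (fun y hy hyδ => ?_) hx hxδ
    · linarith
    · have e : HasDerivAt (fun x => deriv g x - 3 * t * x ^ 2)
          (deriv (deriv g) y - 3 * t * (((2 : ℕ) : ℝ) * y ^ (2 - 1))) y :=
        (d1 y).hasDerivAt.sub ((hasDerivAt_pow 2 y).const_mul (3 * t))
      rw [e.deriv]
      have := k2 y hy hyδ
      norm_num
      linarith
  refine ⟨?_, k1 x hx hxδ, k2 x hx hxδ⟩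
  have := nonneg_of_deriv_nonneg_Icc (g := fun x => g x - t * x ^ 3) (δ := δ)
    (by fun_prop) (by simp [h0]) (fun y hy hyδ => ?_) hx hxδ
  · linarith
  · have e : HasDerivAt (fun x => g x - t * x ^ 3)
        (deriv g y - t * (((3 : ℕ) : ℝ) * y ^ (3 - 1))) y :=
      (d0 y).hasDerivAt.sub ((hasDerivAt_pow 3 y).const_mul t)
    rw [e.deriv]
    have := k1 y hy hyδ
    norm_num
    linarith

namespace IsNeutralFamily

variable {h : UnitAddCircle → UnitAddCircle} {H : ℝ → ℝ}

theorem differentiable (hh : IsNeutralFamily h H) : Differentiable ℝ H :=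
  hh.lift.contDiff.differentiable (by simp)

theorem coe_zero (hh : IsNeutralFamily h H) : ((H 0 : ℝ) : UnitAddCircle) = 0 := by
  rw [← hh.lift.coe_apply, AddCircle.coe_zero, hh.map_zero]

theorem odd_sub (hh : IsNeutralFamily h H) (x : ℝ) : H (-x) - H 0 = -(H x - H 0) := by
  have hc := hh.lift.contDiff.continuous
  have := eq_of_forall_coe_eq_zero (g := fun t => H (-t) + H t) (by fun_prop) (fun t => by
    rw [AddCircle.coe_add, ← hh.lift.coe_apply, ← hh.lift.coe_apply, AddCircle.coe_neg,
      hh.map_neg]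
    simp) x 0
  simp at this
  linarith

theorem deriv_add_int (hh : IsNeutralFamily h H) (k : ℤ) (x : ℝ) :
    deriv H (x + k) = deriv H x := by
  have hc := hh.lift.contDiff.continuous
  have h1 : ∀ t, H (t + k) = H t + (H (0 + k) - H 0) := by
    intro t
    have := eq_of_forall_coe_eq_zero (g := fun t => H (t + k) - H t) (by fun_prop) (fun t => by
      rw [AddCircle.coe_sub, ← hh.lift.coe_apply, ← hh.lift.coe_apply, coe_int_add]
      simp) t 0
    linarith
  have h2 : (fun t => H (t + k)) = fun t => H t + (H (0 + k) - H 0) := funext h1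
  have h3 := congrArg (fun g => deriv g x) h2
  simpa only [deriv_comp_add_const, deriv_add_const] using h3

theorem deriv_nonneg (hh : IsNeutralFamily h H) (x : ℝ) : 0 ≤ deriv H x := by
  by_cases hx : (x : UnitAddCircle) = 0
  · obtain ⟨k, hk⟩ := exists_int_of_coe_eq (s := x) (t := 0) (by simpa using hx)
    have e : x = 0 + k := by linarith
    rw [e, hh.deriv_add_int, hh.deriv_zero]
  · exact (hh.deriv_pos x hx).le

theorem exists_isCubicGerm (hh : IsNeutralFamily h H) :
    ∃ α β δ : ℝ, IsCubicGerm (fun x => H x - H 0) α β δ ∧ δ ≤ 1 / 8 := by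
  set f : ℝ → ℝ := fun x => H x - H 0 with hf
  have c0 : ContDiff ℝ ∞ f := hh.lift.contDiff.sub contDiff_const
  have c1 : ContDiff ℝ ∞ (deriv f) := (contDiff_infty_iff_deriv.1 c0).2
  have c2 : ContDiff ℝ ∞ (deriv (deriv f)) := (contDiff_infty_iff_deriv.1 c1).2
  have c3 : ContDiff ℝ ∞ (deriv (deriv (deriv f))) := (contDiff_infty_iff_deriv.1 c2).2
  have hd : deriv f = deriv H := by funext x; simp [hf]
  have f0 : f 0 = 0 := by simp [hf]
  have f1 : deriv f 0 = 0 := by rw [hd, hh.deriv_zero]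
  -- `0` is a minimum of the derivative
  have f2 : deriv (deriv f) 0 = 0 := by
    refine IsLocalMin.deriv_eq_zero (Filter.Eventually.of_forall fun x => ?_)
    rw [f1, hd]
    exact hh.deriv_nonneg x
  set t := deriv (deriv (deriv f)) 0 with ht
  have ht0 : 0 < t := by
    have := hh.third_deriv_pos
    simp only [iteratedDeriv_succ, iteratedDeriv_zero] at this
    rwa [ht, hd]
  obtain ⟨r, hr, hball⟩ := Metric.continuousAt_iff.1
    (c3.continuous.continuousAt (x := (0 : ℝ))) (t / 2) (by positivity)
  have hthird : ∀ x, 0 ≤ x → x ≤ r / 2 →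
      t / 2 ≤ deriv (deriv (deriv f)) x ∧ deriv (deriv (deriv f)) x ≤ 2 * t := by
    intro x hx hxr
    have := hball (x := x) (by rw [Real.dist_eq, sub_zero, abs_of_nonneg hx]; linarith)
    rw [Real.dist_eq, abs_lt] at this
    constructor <;> linarith
  set δ := min (r / 2) (min (1 / 8) (1 / (1 + t / 3))) with hδ
  have hδ0 : 0 < δ := by positivity
  have hδr : δ ≤ r / 2 := min_le_left _ _
  have hδ8 : δ ≤ 1 / 8 := (min_le_right _ _).trans (min_le_left _ _)
  have hδt : δ ≤ 1 / (1 + t / 3) := (min_le_right _ _).trans (min_le_right _ _)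
  have hlow : ∀ x, 0 ≤ x → x ≤ δ → t / 12 * x ^ 3 ≤ f x ∧ 3 * (t / 12) * x ^ 2 ≤ deriv f x ∧
      6 * (t / 12) * x ≤ deriv (deriv f) x := fun x hx hxδ =>
    cubic_lower_of_deriv c0 f0 f1 f2
      (fun y hy hyδ => by linarith [(hthird y hy (hyδ.trans hδr)).1]) hx hxδ
  refine ⟨t / 12, t / 3, δ, ⟨by positivity, by positivity, hδ0, by linarith, ?_, hh.odd_sub,
    fun x hx hxδ => (hlow x hx hxδ).1, ?_, ?_, ?_⟩, hδ8⟩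
  · rw [le_div_iff₀ (by positivity)] at hδt
    linarith
  · intro x hx hxδ
    have n1 : deriv (fun x => -f x) = fun x => -deriv f x := by funext x; simp
    have n2 : deriv (fun x => -deriv f x) = fun x => -deriv (deriv f) x := by funext x; simp
    have n3 : deriv (fun x => -deriv (deriv f) x) = fun x => -deriv (deriv (deriv f)) x := by
      funext x; simp
    have := (cubic_lower_of_deriv (g := fun x => -f x) (δ := δ) (t := -(t / 3)) c0.neg
      (by simp [f0]) (by simp [n1, f1]) (by simp [n1, n2, f2])
      (fun y hy hyδ => by
        rw [n1, n2, n3]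
        linarith [(hthird y hy (hyδ.trans hδr)).2]) hx hxδ).1
    linarith
  · intro x
    rw [hd]
    exact hh.deriv_nonneg x
  · intro x x' hx' hxx' hxδ
    have d0 : Differentiable ℝ f := c0.differentiable (by simp)
    have d1 : Differentiable ℝ (deriv f) := c1.differentiable (by simp)
    have hmono : MonotoneOn (deriv f) (Set.Icc 0 δ) := by
      refine monotoneOn_of_deriv_nonneg (convex_Icc 0 δ) d1.continuous.continuousOn
        d1.differentiableOn fun y hy => ?_
      rw [interior_Icc] at hy
      exact le_trans (by have := hy.1.le; positivity) (hlow y hy.1.le hy.2.le).2.2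
    refine Convex.image_sub_le_mul_sub_of_deriv_le (convex_Icc x' x) d0.continuous.continuousOn
      d0.differentiableOn (fun y hy => ?_) x' ⟨le_rfl, hxx'⟩ x ⟨hxx', le_rfl⟩ hxx'
    rw [interior_Icc] at hy
    exact hmono ⟨by linarith [hy.1], by linarith [hy.2]⟩ ⟨by linarith, hxδ⟩ hy.2.le

/-- Away from the fixed point the derivative of the circle map is bounded below. -/
theorem exists_le_deriv (hh : IsNeutralFamily h H) {η : ℝ} (hη : 0 < η) :
    ∃ c : ℝ, 0 < c ∧ ∀ x : ℝ, η ≤ |x - round x| → c ≤ deriv H x := by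
  have hc : Continuous (deriv H) := hh.lift.contDiff.continuous_deriv (by simp)
  have hK : IsCompact ({x : ℝ | η ≤ |x|} ∩ Set.Icc (-(1 / 2)) (1 / 2)) :=
    isCompact_Icc.inter_left (isClosed_le continuous_const continuous_abs)
  have hred : ∀ x : ℝ, deriv H x = deriv H (x - round x) := by
    intro x
    rw [← hh.deriv_add_int (round x) (x - round x), sub_add_cancel]
  have hmem : ∀ x : ℝ, η ≤ |x - round x| →
      x - round x ∈ {x : ℝ | η ≤ |x|} ∩ Set.Icc (-(1 / 2)) (1 / 2) := fun x hx =>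
    ⟨hx, abs_le.1 (abs_sub_round x)⟩
  rcases Set.eq_empty_or_nonempty ({x : ℝ | η ≤ |x|} ∩ Set.Icc (-(1 / 2)) (1 / 2)) with he | hne
  · refine ⟨1, one_pos, fun x hx => ?_⟩
    have := hmem x hx
    rw [he] at this
    exact this.elim
  · obtain ⟨z, ⟨hz1, hz2⟩, hz⟩ := hK.exists_isMinOn hne hc.continuousOn
    refine ⟨deriv H z, hh.deriv_pos z fun h0 => ?_, fun x hx => ?_⟩
    · obtain ⟨k, hk⟩ := exists_int_of_coe_eq (s := z) (t := 0) (by simpa using h0)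
      rw [sub_zero] at hk
      have h1 : |z| < 1 := lt_of_le_of_lt (abs_le.2 hz2) (by norm_num)
      rw [hk, ← Int.cast_abs] at h1
      have h2 : k = 0 := Int.abs_lt_one_iff.1 (by exact_mod_cast h1)
      have h3 : η ≤ |z| := hz1
      rw [hk, h2] at h3
      simp at h3
      linarith
    · rw [hred x]
      exact hz (hmem x hx)

end IsNeutralFamily

/-! ### Orbits on the torus -/

/-- The representative of `t` modulo `1` in `[-1/2, 1/2]`. -/
noncomputable def centered (t : ℝ) : ℝ := t - round t

/-- The scale of the class modulo `ℤ²` of a point of the plane. -/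
noncomputable def torusScale (p : ℝ × ℝ) : ℝ := scale (centered p.1) (centered p.2)

theorem norm_coe_eq_abs_centered (t : ℝ) : ‖(t : UnitAddCircle)‖ = |centered t| :=
  UnitAddCircle.norm_eq

theorem abs_centered_le (t : ℝ) : |centered t| ≤ 1 / 2 := abs_sub_round t

theorem abs_centered_le_of_sub_eq_int {t s : ℝ} {k : ℤ} (h : t - s = k) :
    |centered t| ≤ |s| := by
  have := round_le t k
  rwa [show t - (k : ℝ) = s by linarith] at this

theorem torusScale_le_one (p : ℝ × ℝ) : torusScale p ≤ 1 :=
  scale_le zero_le_one (by linarith [abs_centered_le p.1])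
    (by linarith [abs_centered_le p.2])

theorem torusScale_nonneg (p : ℝ × ℝ) : 0 ≤ torusScale p := scale_nonneg _ _

theorem scale_mono {x y x' y' : ℝ} (hx : |x| ≤ |x'|) (hy : |y| ≤ |y'|) :
    scale x y ≤ scale x' y' := max_le_max hx (Real.sqrt_le_sqrt hy)

theorem eq_of_sub_eq_int {s t : ℝ} {k : ℤ} (h : s - t = k) (h1 : |s - t| < 1) : s = t := by
  rw [h, ← Int.cast_abs] at h1
  have : k = 0 := Int.abs_lt_one_iff.1 (by exact_mod_cast h1)
  rw [this, Int.cast_zero] at h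
  linarith

namespace IsNeutralFamily

variable {h : UnitAddCircle → UnitAddCircle} {H : ℝ → ℝ}

theorem deriv_centered (hh : IsNeutralFamily h H) (t : ℝ) : deriv H (centered t) = deriv H t := by
  rw [← hh.deriv_add_int (round t) (centered t), centered, sub_add_cancel]

theorem exists_int_lift (hh : IsNeutralFamily h H) (t : ℝ) :
    ∃ k : ℤ, H t - (H (centered t) - H 0) = k := by
  refine exists_int_of_coe_eq ?_
  have h2 := coe_int_add (round t) (centered t)
  rw [centered, sub_add_cancel] at h2
  rw [AddCircle.coe_sub, hh.coe_zero, sub_zero, ← hh.lift.coe_apply, ← hh.lift.coe_apply, h2]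
  rfl

variable {α β δ : ℝ}

/-- Near the origin the centered coordinates follow the local dynamics exactly. -/
theorem centered_liftInv (hh : IsNeutralFamily h H)
    (hf : IsCubicGerm (fun x => H x - H 0) α β δ) (hδ : δ ≤ 1 / 8) {p : ℝ × ℝ}
    (hp : torusScale p ≤ δ) (hp' : torusScale (liftInv H p) ≤ δ) :
    centered (liftInv H p).1 = centered p.1 - centered p.2 ∧
      centered (liftInv H p).2
        = centered p.2 - (H (centered (liftInv H p).1) - H 0) := by
  have hδ0 := hf.delta_pos
  have h1 := (abs_le_scale _ _).trans hp
  have h2 := (abs_le_scale_sq _ _).trans (pow_le_pow_left₀ (torusScale_nonneg _) hp 2)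
  have h3 := (abs_le_scale _ _).trans hp'
  have h4 := (abs_le_scale_sq _ _).trans (pow_le_pow_left₀ (torusScale_nonneg _) hp' 2)
  have h5 := hf.abs_le h3
  have hsq : δ ^ 2 ≤ 1 / 8 := by nlinarith
  have h6 : β * |centered (liftInv H p).1| ^ 3 ≤ 1 / 8 := by
    have hβ := hf.beta_pos
    have : β * δ ≤ 1 := by linarith [hf.beta_delta_le]
    calc β * |centered (liftInv H p).1| ^ 3 ≤ β * δ ^ 3 := by gcongr
      _ = β * δ * δ ^ 2 := by ring
      _ ≤ 1 * (1 / 8) := by gcongr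
      _ = 1 / 8 := by norm_num
  have h7 := h5.trans h6
  constructor
  · refine eq_of_sub_eq_int (k := -round (liftInv H p).1 + round p.1 - round p.2) ?_ ?_
    · simp only [centered, liftInv]; push_cast; ring
    · rw [abs_lt]
      rw [abs_le] at h1 h2 h3
      constructor <;> linarith
  · obtain ⟨k, hk⟩ := hh.exists_int_lift (liftInv H p).1
    refine eq_of_sub_eq_int (k := -round (liftInv H p).2 + round p.2 - k) ?_ ?_
    · push_cast
      rw [← hk]
      simp only [centered, liftInv]
      ring
    · rw [abs_lt]
      rw [abs_le] at h2 h4 h7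
      constructor <;> linarith

/-- One forward step at most doubles the scale of a point close to the origin. -/
theorem torusScale_le_two_mul (hh : IsNeutralFamily h H)
    (hf : IsCubicGerm (fun x => H x - H 0) α β δ) {p : ℝ × ℝ}
    (hp' : torusScale (liftInv H p) ≤ δ) : torusScale p ≤ 2 * torusScale (liftInv H p) := by
  set x' := centered (liftInv H p).1 with hx'
  set y' := centered (liftInv H p).2 with hy'
  have h1 := hf.scale_le_two_mul (x := x' + (y' + (H x' - H 0))) (y := y' + (H x' - H 0))
    (x' := x') (y' := y') (by ring) (by ring) hp'
  refine le_trans (scale_mono ?_ ?_) h1 <;> obtain ⟨k, hk⟩ := hh.exists_int_lift (liftInv H p).1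
  · refine abs_centered_le_of_sub_eq_int
      (k := round (liftInv H p).1 + round (liftInv H p).2 + k) ?_
    push_cast
    rw [← hk, hx', hy']
    simp only [centered, liftInv]
    ring
  · refine abs_centered_le_of_sub_eq_int (k := round (liftInv H p).2 + k) ?_
    push_cast
    rw [← hk, hx', hy']
    simp only [centered, liftInv]
    ring

/-- At points away from the origin, tangent vectors started in the cone are uniformly transverse to
the horizontal direction: one of the two previous points has first coordinate away from `0`, unless
the orbit starts so late that the cone condition at its start, still away from the origin, gives the
bound. -/
theorem exists_slope_bound (hh : IsNeutralFamily h H)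
    (hf : IsCubicGerm (fun x => H x - H 0) α β δ) {ρ κ : ℝ} (hρ0 : 0 < ρ) (hρδ : ρ ≤ δ)
    (hκ : 0 < κ) :
    ∃ c : ℝ, 0 < c ∧ ∀ (n : ℕ) (p : ℕ → ℝ × ℝ) (a b : ℕ → ℝ),
      (∀ j, p (j + 1) = liftInv H (p j)) →
      IsTangentOrbit (fun j => deriv H (p j).1) n a b → 0 < a n →
      κ * torusScale (p n) * a n ≤ b n → ∀ j ≤ n, ρ ≤ torusScale (p j) → c * a j ≤ b j := by
  have hρ1 : ρ ≤ 1 := hρδ.trans hf.delta_le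
  set η := ρ ^ 2 / 32 with hη
  have hη0 : 0 < η := by positivity
  obtain ⟨c₀, hc₀, hc₀'⟩ := hh.exists_le_deriv hη0
  set e := min 1 (min c₀ (κ * (ρ / 2))) with he
  have he0 : 0 < e := by positivity
  have he1 : e ≤ 1 := min_le_left _ _
  have hec : e ≤ c₀ := (min_le_right _ _).trans (min_le_left _ _)
  have heκ : e ≤ κ * (ρ / 2) := (min_le_right _ _).trans (min_le_right _ _)
  refine ⟨e / 4, by positivity, ?_⟩
  intro n p a b hp ht ha hb j hj hjρ
  have hq : ∀ j, 0 ≤ deriv H (p j).1 := fun j => hh.deriv_nonneg _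
  have hb0 : 0 ≤ b n := le_trans (by have := torusScale_nonneg (p n); positivity) hb
  have hpos := fun i (hi : i ≤ n) => ht.pos hq ha hb0 hi
  have hstep : ∀ i < n, ∀ d, 0 < d → d ≤ 1 → d * a (i + 1) ≤ b i → d / 2 * a i ≤ b i := by
    intro i hi d hd0 hd1 hd
    obtain ⟨-, h2⟩ := ht i hi
    have h3 := (hpos i hi.le).2
    rw [h2]
    nlinarith
  have hfar : ∀ i < n, η ≤ |centered (p (i + 1)).1| → e / 2 * a i ≤ b i := by
    intro i hi hx
    obtain ⟨h1, -⟩ := ht i hi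
    have h3 := hpos (i + 1) hi
    refine hstep i hi e he0 he1 ?_
    have := mul_le_mul_of_nonneg_right (hec.trans (hc₀' _ hx)) h3.1.le
    linarith
  have hend : ∀ i, n = i → ρ / 2 ≤ torusScale (p i) → e * a i ≤ b i := by
    rintro i rfl hi
    refine le_trans ?_ hb
    have : κ * (ρ / 2) ≤ κ * torusScale (p n) := by gcongr
    gcongr
    linarith
  have hprev : ρ / 2 ≤ torusScale (p (j + 1)) := by
    by_contra hc
    have hc' := not_le.1 hc
    have := hh.torusScale_le_two_mul hf (p := p j) (by rw [← hp j]; linarith)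
    rw [← hp j] at this
    linarith
  have haj := (hpos j hj).1
  rcases hj.eq_or_lt with h0 | h0
  · have := hend j h0.symm (by linarith)
    nlinarith
  have haj' := (hpos (j + 1) h0).1
  have hbmono := (ht.antitone hq ha hb0 (i := j) (j := j + 1) (by omega) h0).2
  by_cases hx1 : η ≤ |centered (p (j + 1)).1|
  · have := hfar j h0 hx1
    nlinarith
  rcases (Nat.succ_le_of_lt h0).eq_or_lt with h1 | h1
  · have h2 := hend (j + 1) h1.symm hprev
    have := hstep j h0 e he0 he1 (h2.trans hbmono)
    nlinarith
  by_cases hx2 : η ≤ |centered (p (j + 1 + 1)).1|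
  · have h2 := hfar (j + 1) h1 hx2
    have := hstep j h0 (e / 2) (by positivity) (by linarith) (h2.trans hbmono)
    linarith
  · -- two consecutive small first coordinates force the point in between to be close to the origin
    exfalso
    rw [not_le] at hx1 hx2
    have h2 : |centered (p (j + 1)).2| ≤
        |centered (p (j + 1)).1 - centered (p (j + 1 + 1)).1| := by
      refine abs_centered_le_of_sub_eq_int
        (k := round (p (j + 1)).1 - round (p (j + 1 + 1)).1) ?_
      rw [hp (j + 1)]
      simp only [centered, liftInv]
      push_cast
      ring
    have h3 := h2.trans (abs_sub _ _)
    have h4 : torusScale (p (j + 1)) ≤ ρ / 4 :=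
      scale_le (by positivity) (by nlinarith) (by nlinarith)
    linarith

/-- Quadratic expansion along arbitrary orbits: the orbit is cut at its visits outside a
neighbourhood of the origin. -/
theorem exists_expansion (hh : IsNeutralFamily h H) {κ : ℝ} (hκ : 0 < κ) :
    ∃ ε ρ : ℝ, 0 < ε ∧ 0 < ρ ∧ ρ ≤ 1 ∧ ∀ (n : ℕ) (p : ℕ → ℝ × ℝ) (a b : ℕ → ℝ),
      (∀ j, p (j + 1) = liftInv H (p j)) →
      IsTangentOrbit (fun j => deriv H (p j).1) n a b → 0 < a n →
      κ * torusScale (p n) * a n ≤ b n →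
      (1 + ε * min (torusScale (p 0)) ρ * n) ^ 2 * a n ≤ a 0 := by
  obtain ⟨α, β, δ, hf, hδ8⟩ := hh.exists_isCubicGerm
  have hδ0 := hf.delta_pos
  set ρ := δ / 2 with hρ
  have hρ0 : 0 < ρ := by positivity
  have hρδ : ρ ≤ δ := by linarith
  obtain ⟨c, hc0, hslope⟩ := hh.exists_slope_bound hf hρ0 hρδ hκ
  -- an initial slope admissible both in the cone and just after a visit outside
  obtain ⟨c₁, hc₁, hc₁κ, hc₁c, hc₁1⟩ : ∃ c₁, 0 < c₁ ∧ c₁ ≤ κ ∧ 2 * c₁ ≤ c ∧ c₁ ≤ 1 / 2 :=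
    ⟨min κ (min (c / 2) (1 / 2)), by positivity, min_le_left _ _, by
      linarith [(min_le_right κ (min (c / 2) (1 / 2))).trans (min_le_left _ _)],
      (min_le_right _ _).trans (min_le_right _ _)⟩
  obtain ⟨ε₁, hε₁, hloc⟩ := hf.local_expansion hc₁
  set ε := min ε₁ (min 1 (c / 3)) with hε
  have hε0 : 0 < ε := by positivity
  have hε1 : ε ≤ ε₁ := min_le_left _ _
  have hε2 : ε ≤ 1 := (min_le_right _ _).trans (min_le_left _ _)
  have hε3 : ε ≤ c / 3 := (min_le_right _ _).trans (min_le_right _ _)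
  have hderiv : deriv (fun x => H x - H 0) = deriv H := by funext x; simp
  -- the part of the orbit after its last visit outside the neighbourhood
  have hblock : ∀ (m : ℕ) (p : ℕ → ℝ × ℝ) (a b : ℕ → ℝ),
      (∀ j, p (j + 1) = liftInv H (p j)) →
      IsTangentOrbit (fun j => deriv H (p j).1) m a b → 0 < a m →
      c₁ * torusScale (p m) * a m ≤ b m → (∀ j, 1 ≤ j → j ≤ m → torusScale (p j) < ρ) →
      (1 + ε * min (torusScale (p 0)) ρ * m) ^ 2 * a m ≤ a 0 := by
    intro m p a b hp ht ha hb hsmall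
    rcases Nat.eq_zero_or_pos m with rfl | hm
    · simp
    have hN : ∀ j ≤ m, torusScale (p j) ≤ δ := by
      intro j hj
      rcases Nat.eq_zero_or_pos j with rfl | hj0
      · have h1 := hsmall 1 le_rfl hm
        have h2 := hh.torusScale_le_two_mul hf (p := p 0) (by rw [← hp 0]; linarith)
        rw [← hp 0] at h2
        linarith
      · linarith [hsmall j hj0 hj]
    have ho : IsBackwardOrbit (fun x => H x - H 0) m (fun j => centered (p j).1)
        (fun j => centered (p j).2) := by
      intro j hj
      have := hh.centered_liftInv hf hδ8 (hN j hj.le) (by rw [← hp j]; exact hN (j + 1) hj)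
      simpa only [hp j] using this
    have h1 := hloc m _ _ a b ho hN (by simpa only [hderiv, hh.deriv_centered] using ht) ha hb
    refine le_trans ?_ h1
    have h2 : min (torusScale (p 0)) ρ ≤ scale (centered (p 0).1) (centered (p 0).2) :=
      min_le_left _ _
    have h3 : 0 ≤ min (torusScale (p 0)) ρ := le_min (torusScale_nonneg _) hρ0.le
    gcongr
  refine ⟨ε, ρ, hε0, hρ0, by linarith, ?_⟩
  intro n
  induction n using Nat.strong_induction_on with
  | _ n ih =>
  intro p a b hp ht ha hb
  have hq : ∀ j, 0 ≤ deriv H (p j).1 := fun j => hh.deriv_nonneg _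
  have hb0 : 0 ≤ b n := le_trans (by have := torusScale_nonneg (p n); positivity) hb
  by_cases hex : ∃ j, 1 ≤ j ∧ j ≤ n ∧ ρ ≤ torusScale (p j)
  · classical
    obtain ⟨hj1, hjn, hjρ⟩ := Nat.find_spec hex
    have hmin : ∀ i, 1 ≤ i → i < Nat.find hex → torusScale (p i) < ρ := by
      intro i hi1 hi
      have := Nat.find_min hex hi
      by_contra hc
      exact this ⟨hi1, by omega, not_lt.1 hc⟩
    generalize Nat.find hex = j at hj1 hjn hjρ hmin
    obtain ⟨i, rfl⟩ : ∃ i, j = i + 1 := ⟨j - 1, by omega⟩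
    have h1 := ih (n - (i + 1)) (by omega) (fun l => p (i + 1 + l)) (fun l => a (i + 1 + l))
      (fun l => b (i + 1 + l)) (fun l => hp (i + 1 + l)) (ht.shift (i + 1))
      (by rwa [Nat.add_sub_cancel' hjn]) (by rwa [Nat.add_sub_cancel' hjn])
    simp only [add_zero, Nat.add_sub_cancel' hjn, min_eq_right hjρ] at h1
    have h2 := hslope n p a b hp ht ha hb (i + 1) hjn hjρ
    obtain ⟨t1, t2⟩ := ht i (by omega)
    have hai := (ht.pos hq ha hb0 (j := i) (by omega)).1
    have hai' := (ht.pos hq ha hb0 hjn).1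
    have hbi := (ht.antitone hq ha hb0 (i := i) (j := i + 1) (by omega) hjn).2
    have h3 : (1 + c) * a (i + 1) ≤ a i := by linarith
    have h4 : c₁ * torusScale (p i) * a i ≤ b i := by
      have h5 : c₁ * torusScale (p i) ≤ c₁ * 1 := by gcongr; exact torusScale_le_one _
      have h6 : c₁ * torusScale (p i) * a i ≤ c₁ * 1 * a i := by gcongr
      have h7 : 2 * c₁ * a (i + 1) ≤ c * a (i + 1) := by gcongr
      have h9 : 0 ≤ b i := (ht.pos hq ha hb0 (j := i) (by omega)).2
      have h8 : c₁ * b i ≤ 1 / 2 * b i := by gcongr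
      rw [t2] at h6 ⊢
      linarith
    have h5 := hblock i p a b hp (ht.mono (by omega)) hai h4
      (fun l hl1 hl => hmin l hl1 (by omega))
    set M := min (torusScale (p 0)) ρ with hM
    have hM0 : 0 ≤ M := le_min (torusScale_nonneg _) hρ0.le
    have hMρ : M ≤ ρ := min_le_right _ _
    have hM1 : M ≤ 1 := by linarith
    have h6 : (1 + ε * M) ^ 2 ≤ 1 + c := by
      have : ε * M ≤ ε * 1 := by gcongr
      have : 0 ≤ ε * M := by positivity
      nlinarith
    obtain ⟨l, hl⟩ : ∃ l : ℕ, n - (i + 1) = l := ⟨_, rfl⟩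
    rw [hl] at h1
    have hn : (n : ℝ) = i + 1 + l := by
      have : n = i + 1 + l := by omega
      rw [this]; push_cast; ring
    have h7 : 1 + ε * M * n ≤ (1 + ε * M * i) * (1 + ε * M) * (1 + ε * M * l) := by
      rw [hn]
      have hs : 0 ≤ ε * M := by positivity
      set s := ε * M
      have : (1 + s * i) * (1 + s) * (1 + s * l) - (1 + s * (i + 1 + l))
        = s * i * s + s * l * (s * i + s + s * i * s) := by ring
      have : 0 ≤ s * i * s + s * l * (s * i + s + s * i * s) := by positivity
      linarith
    calc (1 + ε * M * n) ^ 2 * a n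
        ≤ ((1 + ε * M * i) * (1 + ε * M) * (1 + ε * M * l)) ^ 2 * a n := by gcongr
      _ = (1 + ε * M * i) ^ 2 * ((1 + ε * M) ^ 2 * ((1 + ε * M * l) ^ 2 * a n)) := by ring
      _ ≤ (1 + ε * M * i) ^ 2 * ((1 + c) * ((1 + ε * ρ * l) ^ 2 * a n)) := by gcongr
      _ ≤ (1 + ε * M * i) ^ 2 * ((1 + c) * a (i + 1)) := by gcongr
      _ ≤ (1 + ε * M * i) ^ 2 * a i := by gcongr
      _ ≤ a 0 := h5
  · refine hblock n p a b hp ht ha (le_trans ?_ hb) fun j hj1 hjn => ?_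
    · have := torusScale_nonneg (p n)
      gcongr
    · by_contra hc
      exact hex ⟨j, hj1, hjn, not_lt.1 hc⟩

end IsNeutralFamily

/-! ### Derivatives of the iterates -/

section Derivatives

variable {H : ℝ → ℝ}

theorem iterate_apply_of_leftInverse (n : ℕ) (p : ℝ × ℝ) :
    (liftMap H)^[n] ((liftInv H)^[n] p) = p :=
  Function.LeftInverse.iterate (fun q => by ext <;> simp [liftMap, liftInv]) n p

theorem differentiable_liftMap (hH : Differentiable ℝ H) : Differentiable ℝ (liftMap H) := by
  unfold liftMap; fun_prop

theorem differentiable_liftInv (hH : Differentiable ℝ H) : Differentiable ℝ (liftInv H) := by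
  unfold liftInv; fun_prop

theorem differentiable_iterate {E : Type*} [NormedAddCommGroup E] [NormedSpace ℝ E] {g : E → E}
    (hg : Differentiable ℝ g) (n : ℕ) : Differentiable ℝ g^[n] := by
  induction n with
  | zero => exact differentiable_id
  | succ n ih => rw [Function.iterate_succ]; exact ih.comp hg

theorem fderiv_liftMap (hH : Differentiable ℝ H) (p w : ℝ × ℝ) :
    fderiv ℝ (liftMap H) p w
      = (w.1 + (deriv H p.1 * w.1 + w.2), deriv H p.1 * w.1 + w.2) := by
  have h1 : HasFDerivAt (fun q : ℝ × ℝ => H q.1)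
      (deriv H p.1 • ContinuousLinearMap.fst ℝ ℝ ℝ) p :=
    (hH p.1).hasDerivAt.comp_hasFDerivAt p hasFDerivAt_fst
  have h2 : HasFDerivAt (liftMap H) _ p :=
    ((hasFDerivAt_fst.add h1).add hasFDerivAt_snd).prodMk (h1.add hasFDerivAt_snd)
  rw [h2.fderiv]
  ext <;> simp [add_assoc]

theorem fderiv_liftInv (hH : Differentiable ℝ H) (p w : ℝ × ℝ) :
    fderiv ℝ (liftInv H) p w
      = (w.1 - w.2, w.2 - deriv H (p.1 - p.2) * (w.1 - w.2)) := by
  have h0 : HasFDerivAt (fun q : ℝ × ℝ => q.1 - q.2)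
      (ContinuousLinearMap.fst ℝ ℝ ℝ - ContinuousLinearMap.snd ℝ ℝ ℝ) p :=
    hasFDerivAt_fst.sub hasFDerivAt_snd
  have h1 : HasFDerivAt (fun q : ℝ × ℝ => H (q.1 - q.2))
      (deriv H (p.1 - p.2) • (ContinuousLinearMap.fst ℝ ℝ ℝ - ContinuousLinearMap.snd ℝ ℝ ℝ)) p :=
    (hH (p.1 - p.2)).hasDerivAt.comp_hasFDerivAt p h0
  have h2 : HasFDerivAt (liftInv H) _ p := h0.prodMk (hasFDerivAt_snd.sub h1)
  rw [h2.fderiv]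
  ext <;> simp

theorem fderiv_iterate_succ_apply {g : ℝ × ℝ → ℝ × ℝ} (hg : Differentiable ℝ g) (n : ℕ)
    (p w : ℝ × ℝ) : fderiv ℝ g^[n + 1] p w = fderiv ℝ g (g^[n] p) (fderiv ℝ g^[n] p w) := by
  rw [Function.iterate_succ', fderiv_comp p (hg _) (differentiable_iterate hg n p)]
  rfl

/-- The map preserves area. -/
theorem fderiv_iterate_liftMap_det (hH : Differentiable ℝ H) (n : ℕ) (p v w : ℝ × ℝ) :
    (fderiv ℝ (liftMap H)^[n] p v).1 * (fderiv ℝ (liftMap H)^[n] p w).2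
        - (fderiv ℝ (liftMap H)^[n] p v).2 * (fderiv ℝ (liftMap H)^[n] p w).1
      = v.1 * w.2 - v.2 * w.1 := by
  induction n with
  | zero => simp [show (liftMap H)^[0] = id from rfl]
  | succ n ih =>
    simp only [fderiv_iterate_succ_apply (differentiable_liftMap hH), fderiv_liftMap hH]
    rw [← ih]
    ring

theorem fderiv_iterate_liftMap_liftInv (hH : Differentiable ℝ H) (n : ℕ) (p w : ℝ × ℝ) :
    fderiv ℝ (liftMap H)^[n] ((liftInv H)^[n] p) (fderiv ℝ (liftInv H)^[n] p w) = w := by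
  have e : (liftMap H)^[n] ∘ (liftInv H)^[n] = id :=
    funext (iterate_apply_of_leftInverse n)
  have h := fderiv_comp p (differentiable_iterate (differentiable_liftMap hH) n _)
    (differentiable_iterate (differentiable_liftInv hH) n p)
  rw [e, fderiv_id] at h
  exact (congrArg (fun L : ℝ × ℝ →L[ℝ] ℝ × ℝ => L w) h).symm

/-- The inverse map keeps the stable quadrant and does not contract first coordinates there. -/
theorem fderiv_iterate_liftInv_mem (hH : Differentiable ℝ H) (hd : ∀ x, 0 ≤ deriv H x) (n : ℕ)
    (p : ℝ × ℝ) {w : ℝ × ℝ} (h1 : 0 ≤ w.1) (h2 : w.2 ≤ 0) :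
    w.1 ≤ (fderiv ℝ (liftInv H)^[n] p w).1 ∧ (fderiv ℝ (liftInv H)^[n] p w).2 ≤ 0 := by
  induction n with
  | zero => simpa [show (liftInv H)^[0] = id from rfl] using h2
  | succ n ih =>
    simp only [fderiv_iterate_succ_apply (differentiable_liftInv hH), fderiv_liftInv hH]
    obtain ⟨h3, h4⟩ := ih
    refine ⟨by linarith, ?_⟩
    have := mul_nonneg (hd (((liftInv H)^[n] p).1 - ((liftInv H)^[n] p).2))
      (show 0 ≤ (fderiv ℝ (liftInv H)^[n] p w).1 - (fderiv ℝ (liftInv H)^[n] p w).2 by linarith)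
    linarith

/-- The images of a vector under the derivatives of the forward iterates form a tangent orbit. -/
theorem isTangentOrbit_fderiv (hH : Differentiable ℝ H) (n : ℕ) (p w : ℝ × ℝ) :
    IsTangentOrbit (fun j => deriv H ((liftInv H)^[j] p).1) n
      (fun j => (fderiv ℝ (liftMap H)^[n - j] ((liftInv H)^[n] p) w).1)
      (fun j => (fderiv ℝ (liftMap H)^[n - j] ((liftInv H)^[n] p) w).2) := by
  intro j hj
  have e1 : n - j = (n - (j + 1)) + 1 := by omega
  have e2 : (liftMap H)^[n - (j + 1)] ((liftInv H)^[n] p) = (liftInv H)^[j + 1] p := by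
    conv_lhs => rw [show n = (n - (j + 1)) + (j + 1) by omega, Function.iterate_add_apply]
    simp only [Nat.add_sub_cancel]
    exact iterate_apply_of_leftInverse _ _
  simp only [e1, fderiv_iterate_succ_apply (differentiable_liftMap hH), fderiv_liftMap hH, e2]
  exact ⟨add_comm _ _, trivial⟩

end Derivatives

theorem torusProj_liftInv_iterate {h : UnitAddCircle → UnitAddCircle} {H : ℝ → ℝ}
    (hH : IsSmoothLift h H) (n : ℕ) (ξ : Torus2) :
    torusProj ((liftInv H)^[n] (torusRep ξ)) = (intermittentMap h).symm^[n] ξ := by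
  have := Function.Semiconj.iterate_right (f := torusProj) (torusProj_liftInv hH) n (torusRep ξ)
  rwa [torusProj_torusRep] at this

theorem scale_norm_torusProj (p : ℝ × ℝ) :
    scale ‖(torusProj p).1‖ ‖(torusProj p).2‖ = torusScale p := by
  simp [scale, torusScale, torusProj, norm_coe_eq_abs_centered]

theorem norm_le_half (x : UnitAddCircle) : ‖x‖ ≤ 1 / 2 := by
  simpa using AddCircle.norm_le_half_period (1 : ℝ) one_ne_zero (x := x)

/-! ### Expansion and contraction -/

theorem mainTheorem5 (h : UnitAddCircle → UnitAddCircle) (H : ℝ → ℝ) (hh : IsNeutralFamily h H)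
    (Kminus Kplus : ℝ) (hKminus : 0 < Kminus) (hKplus : 0 < Kplus) :
    ∃ K : ℝ, 0 < K ∧
      (∀ ξ : Torus2, ξ ≠ 0 → ∀ (n : ℕ) (u : ℝ),
        (1, u) ∈ narrowCone Kminus Kplus ((intermittentMap h).symm^[n] ξ) →
          Real.exp (-K * ‖ξ.1‖) * (K⁻¹ * ‖ξ.1‖ * n + 1) ^ 2 ≤ expansion h H n ξ u) ∧
      (∀ (ξ : Torus2) (n : ℕ) (u v : ℝ),
        (1, u) ∈ narrowCone Kminus Kplus ((intermittentMap h).symm^[n] ξ) → 0 ≤ v →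
          Real.exp (-K * ‖ξ.1‖) * (K⁻¹ * ‖ξ.1‖ * n + 1) ^ 2 *
              ((unstableSlope h H n ξ u + v) / (u + stableSlope H n ξ v))
            ≤ contraction H n ξ v) := by
  have hH := hh.differentiable
  obtain ⟨ε, ρ, hε, hρ, hρ1, hexp⟩ := hh.exists_expansion hKminus
  set K := (ε * ρ)⁻¹ with hK
  have hK0 : 0 < K := by positivity
  have hfwd : ∀ (ξ : Torus2) (n : ℕ), tangentFwd H n ((intermittentMap h).symm^[n] ξ)
      = fderiv ℝ (liftMap H)^[n] ((liftInv H)^[n] (torusRep ξ)) := fun ξ n => by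
    rw [← torusProj_liftInv_iterate hh.lift, tangentFwd_torusProj hh.lift]
  -- the expansion estimate holds at every point, the origin included
  have hmain : ∀ (ξ : Torus2) (n : ℕ) (u : ℝ),
      (1, u) ∈ narrowCone Kminus Kplus ((intermittentMap h).symm^[n] ξ) →
        Real.exp (-K * ‖ξ.1‖) * (K⁻¹ * ‖ξ.1‖ * n + 1) ^ 2 ≤ expansion h H n ξ u := by
    intro ξ n u hu
    obtain ⟨-, hu1, -⟩ := hu
    have h1 := hexp n (fun j => (liftInv H)^[j] (torusRep ξ)) _ _
      (fun j => Function.iterate_succ_apply' _ _ _)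
      (isTangentOrbit_fderiv hH n (torusRep ξ) (1, u)) (by simp) ?_
    · simp only [Nat.sub_self, Nat.sub_zero, Function.iterate_zero, fderiv_id,
        ContinuousLinearMap.id_apply, mul_one] at h1
      rw [expansion, hfwd]
      refine le_trans ?_ h1
      have h2 : Real.exp (-K * ‖ξ.1‖) ≤ 1 := by
        apply Real.exp_le_one_iff.2
        have := norm_nonneg ξ.1
        nlinarith
      have h3 : K⁻¹ * ‖ξ.1‖ ≤ ε * min (torusScale (id (torusRep ξ))) ρ := by
        rw [hK, inv_inv, mul_assoc]
        refine mul_le_mul_of_nonneg_left (le_min ?_ ?_) hε.le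
        · have h4 : ‖ξ.1‖ ≤ torusScale (torusRep ξ) := by
            rw [← scale_norm_torusProj, torusProj_torusRep]
            simpa using abs_le_scale ‖ξ.1‖ ‖ξ.2‖
          have := norm_nonneg ξ.1
          simp only [id]
          nlinarith
        · have := norm_le_half ξ.1
          nlinarith
      have h5 : 0 ≤ K⁻¹ * ‖ξ.1‖ := by positivity
      calc Real.exp (-K * ‖ξ.1‖) * (K⁻¹ * ‖ξ.1‖ * n + 1) ^ 2
          ≤ 1 * (K⁻¹ * ‖ξ.1‖ * n + 1) ^ 2 := by gcongr
        _ = (1 + K⁻¹ * ‖ξ.1‖ * n) ^ 2 := by ring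
        _ ≤ (1 + ε * min (torusScale (id (torusRep ξ))) ρ * n) ^ 2 := by gcongr
    · simp only [Nat.sub_self, Function.iterate_zero, fderiv_id, ContinuousLinearMap.id_apply,
        mul_one]
      refine le_trans ?_ hu1
      rw [← scale_norm_torusProj, torusProj_liftInv_iterate hh.lift]
      gcongr
      simpa using scale_le_add ‖((intermittentMap h).symm^[n] ξ).1‖
        ‖((intermittentMap h).symm^[n] ξ).2‖
  refine ⟨K, hK0, fun ξ _ => hmain ξ, fun ξ n u v hu hv => ?_⟩
  have hE := hmain ξ n u hu
  set E := Real.exp (-K * ‖ξ.1‖) * (K⁻¹ * ‖ξ.1‖ * n + 1) ^ 2 with hEdef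
  have hE0 : 0 < E := by positivity
  have hl0 : 0 < expansion h H n ξ u := hE0.trans_le hE
  -- conservation of the area spanned by the two vectors
  have harea : expansion h H n ξ u * (unstableSlope h H n ξ u + v)
      = contraction H n ξ v * (u + stableSlope H n ξ v) ∧ 1 ≤ contraction H n ξ v := by
    have h1 := fderiv_iterate_liftInv_mem hH hh.deriv_nonneg n (torusRep ξ) (w := (1, -v))
      zero_le_one (by simpa using hv)
    have h2 := fderiv_iterate_liftMap_det hH n ((liftInv H)^[n] (torusRep ξ)) (1, u)
      (fderiv ℝ (liftInv H)^[n] (torusRep ξ) (1, -v))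
    rw [fderiv_iterate_liftMap_liftInv hH, ← hfwd] at h2
    have h3 : 1 ≤ contraction H n ξ v := h1.1
    refine ⟨?_, h3⟩
    have h4 : contraction H n ξ v * stableSlope H n ξ v = -(tangentBwd H n ξ (1, -v)).2 := by
      rw [stableSlope, mul_div_cancel₀ _ (by linarith)]
    have h5 : expansion h H n ξ u * unstableSlope h H n ξ u
        = (tangentFwd H n ((intermittentMap h).symm^[n] ξ) (1, u)).2 := by
      rw [unstableSlope, mul_div_cancel₀ _ hl0.ne']
    rw [mul_add, mul_add, h4, h5]
    change expansion h H n ξ u * (-v) - _ * 1 = 1 * (tangentBwd H n ξ (1, -v)).2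
      - u * contraction H n ξ v at h2
    linarith
  obtain ⟨harea, hc1⟩ := harea
  rcases eq_or_ne (u + stableSlope H n ξ v) 0 with h0 | h0
  · rw [h0, div_zero, mul_zero]
    linarith
  · have h1 : (unstableSlope h H n ξ u + v) / (u + stableSlope H n ξ v)
        = contraction H n ξ v / expansion h H n ξ u := by
      rw [div_eq_div_iff h0 hl0.ne', mul_comm, harea]
    rw [h1, mul_div_assoc', div_le_iff₀ hl0, mul_comm]
    gcongr
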